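/- Let $\mathcal S$ be the orbifold whose underlying space is a closed 3-ball and whose singular locus is a pair of disjoint, unknotted and unlinked properly embedded arcs, each a cone axis of order $3$ (cone angle $2\pi/3$), so that $\pi_1(\mathcal S)\cong \mathbb Z/3 * \mathbb Z/3$. Explicitly, $\mathcal S$ is the quotient of $\{z\in\mathbb C:|z|\le 1\}\times\mathbb R$ by the group generated by $(z,u)\mapsto(z,u+2)$ and $(z,u)\mapsto(\bar z,-u)$, and the axes are the images of $[-1,1]\times\{0\}$ and $[-1,1]\times\{1\}$. The boundary $\partial\mathcal S$ is a sphere with four cone points; it is the quotient of the plane by the group generated by the rotations by $\pi$ about the points of $\mathbb Z^2$, through $(u,v)\mapsto[(e^{i\pi v},u)]$, the cone points being the images of the points of $\mathbb Z^2$. The vertical lines $u=\text{const}\notin\mathbb Z$ project to the boundary $\partial m$ of a meridian disk separating the two axes. For $p/q\in\mathbb Q\cup\{\infty\}$ in lowest terms with $q\ge 0$ (and $\infty=1/0$), let $\gamma_{p/q}$ be the unoriented homotopy class, on $\partial\mathcal S$ minus the cone points, of the simple closed curve covered by a line of slope $p/q$ in the plane which contains no point of $\mathbb Z^2$. (These are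 the essential non-peripheral simple closed curves on $\partial\mathcal S$; $\gamma_{p/q}$ meets $\partial m$ in $2q$ points and has twist $p$, and $\gamma_{1/0}=\partial m$.) Two unoriented curves on $\partial\mathcal S$ minus the cone points are homotopic in $\mathcal S$ if, with suitable orientations, they are freely homotopic in the orbifold $\mathcal S$, that is, if they represent the same conjugacy class of $\pi_1(\mathcal S)$, where $\pi_1(\mathcal S)$ is the fundamental group of $\mathcal S$ minus its axes modulo the normal closure of the cubes of the meridians of the axes. **Proposition.** For all $p/q,\,p'/q'\in\mathbb Q\cup\{\infty\}$, the unoriented curves $\gamma_{p/q}$ and $\gamma_{p'/q'}$ are homotopic in $\mathcal S$ if and only if $p'/q'=\pm p/q+2k$ for some $k\in\mathbb Z$ (where $\pm\infty+2k=\infty$). -/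

import Mathlib

open scoped ComplexConjugate OnePoint

noncomputable section

namespace ConedBall

/-! ## The coned ball

Let `D` be the closed unit disk in `ℂ`.  The infinite dihedral group generated by
`(z, u) ↦ (z, u + 2)` and `(z, u) ↦ (conj z, -u)` acts on the solid cylinder `D × ℝ`.
A fundamental domain is `D × [0, 1]`, so the quotient is obtained from the cylinder `D × [0, 1]` by
folding each of its end disks along the diameter `z ∈ [-1, 1]`.  It is a closed 3-ball, and the two
fold lines are a pair of unknotted, unlinked, properly embedded arcs, the two cone axes.  The
meridian disk `m = {u = 1/2}` cuts it into two halves, each a ball with one axis. -/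

/-- The solid cylinder `D × ℝ`. -/
abbrev Cylinder : Type := {w : ℂ × ℝ // ‖w.1‖ ≤ 1}

/-- Two points of the cylinder are identified when they differ by an element of the dihedral
group generated by `(z, u) ↦ (z, u + 2)` and `(z, u) ↦ (conj z, -u)`. -/
def dihedralSetoid : Setoid Cylinder where
  r w w' := ∃ k : ℤ, (w'.1.1 = w.1.1 ∧ w'.1.2 = w.1.2 + 2 * k) ∨
    (w'.1.1 = conj w.1.1 ∧ w'.1.2 = -w.1.2 + 2 * k)
  iseqv := by
    refine ⟨fun w => ⟨0, Or.inl ⟨rfl, by simp⟩⟩, ?_, ?_⟩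
    · rintro w w' ⟨k, ⟨h1, h2⟩ | ⟨h1, h2⟩⟩
      · exact ⟨-k, Or.inl ⟨h1.symm, by push_cast; linarith⟩⟩
      · exact ⟨k, Or.inr ⟨by simp [h1], by linarith⟩⟩
    · rintro w w' w'' ⟨k, ⟨h1, h2⟩ | ⟨h1, h2⟩⟩ ⟨l, ⟨h3, h4⟩ | ⟨h3, h4⟩⟩
      · exact ⟨k + l, Or.inl ⟨by rw [h3, h1], by push_cast; linarith⟩⟩
      · exact ⟨l - k, Or.inr ⟨by rw [h3, h1], by push_cast; linarith⟩⟩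
      · exact ⟨k + l, Or.inr ⟨by rw [h3, h1], by push_cast; linarith⟩⟩
      · exact ⟨l - k, Or.inl ⟨by simp [h3, h1], by push_cast; linarith⟩⟩

/-- The underlying space of the coned ball `S`. -/
abbrev S : Type := Quotient dihedralSetoid

/-- The projection of the cylinder to `S`. -/
def proj (w : Cylinder) : S := Quotient.mk dihedralSetoid w

lemma continuous_proj : Continuous proj := continuous_quotient_mk'

/-- The `j`-th cone axis: the image of `[-1, 1] × {j}`.  It depends only on the parity of `j`, so
`coneAxis 0` and `coneAxis 1` are the two axes. -/
def coneAxis (j : ℤ) : Set S := proj '' {w | w.1.1.im = 0 ∧ w.1.2 = j}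

/-- The singular locus of `S`, the union of the two cone axes. -/
def singularLocus : Set S := coneAxis 0 ∪ coneAxis 1

/-- The boundary sphere `∂S`. -/
def boundary : Set S := proj '' {w | ‖w.1.1‖ = 1}

/-- The regular part of `S`: the ball with the two cone axes removed. -/
abbrev Regular : Type := {s : S // s ∉ singularLocus}

/-- The boundary sphere with the four cone points (the ends of the axes) removed. -/
abbrev PuncturedBoundary : Type := {s : S // s ∈ boundary ∧ s ∉ singularLocus}

/-- The inclusion of the punctured boundary into the regular part of `S`. -/
def inclusion (s : PuncturedBoundary) : Regular := ⟨s.1, s.2.2⟩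

lemma continuous_inclusion : Continuous inclusion :=
  continuous_subtype_val.subtype_mk _

/-- A point of the cylinder projects into the singular locus only if it lies on one of the
segments `[-1, 1] × {n}`, `n ∈ ℤ`. -/
lemma proj_notMem_singularLocus {w : Cylinder}
    (h : ¬(w.1.1.im = 0 ∧ ∃ n : ℤ, w.1.2 = n)) : proj w ∉ singularLocus := by
  have key : ∀ j : ℤ, proj w ∉ coneAxis j := by
    rintro j ⟨w', ⟨h1, h2⟩, h3⟩
    obtain ⟨k, ⟨h4, h5⟩ | ⟨h4, h5⟩⟩ := (Quotient.exact h3 : dihedralSetoid.r w' w)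
    · exact h ⟨by rw [h4, h1], j + 2 * k, by push_cast; linarith⟩
    · exact h ⟨by simp [h4, h1], -j + 2 * k, by push_cast; linarith⟩
  rintro (h' | h')
  · exact key 0 h'
  · exact key 1 h'

/-! ## Homotopy of loops -/

/-- Free homotopy of based loops in a space `X`: the second loop becomes homotopic to the first one
relative to the base point after transport along some path `c` between the base points. -/
def FreelyHomotopic {X : Type*} [TopologicalSpace X] {x y : X} (α : Path x x) (β : Path y y) :
    Prop :=
  ∃ c : Path x y, Path.Homotopic α ((c.trans β).trans c.symm)

/-- The half circle `t ↦ (i cos (πt) / 2, j + sin (πt) / 2)`, `0 ≤ t ≤ 1`, of radius `1/2` about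
the point `(0, j)` in the cylinder. -/
def meridianLift (j : ℤ) (t : ℝ) : Cylinder :=
  ⟨(((Real.cos (Real.pi * t) / 2 : ℝ) : ℂ) * Complex.I, j + Real.sin (Real.pi * t) / 2), by
    have := Real.abs_cos_le_one (Real.pi * t)
    simp only [norm_mul, Complex.norm_real, Complex.norm_I, mul_one, Real.norm_eq_abs, abs_div,
      abs_two]
    linarith⟩

lemma continuous_meridianLift (j : ℤ) : Continuous (meridianLift j) := by
  unfold meridianLift; fun_prop

lemma meridianLift_regular (j : ℤ) (t : ℝ) : proj (meridianLift j t) ∉ singularLocus := by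
  apply proj_notMem_singularLocus
  rintro ⟨h1, n, h2⟩
  simp only [meridianLift, Complex.mul_im, Complex.ofReal_re, Complex.ofReal_im, Complex.I_re,
    Complex.I_im, mul_one, mul_zero, add_zero] at h1 h2
  have h3 : Real.cos (Real.pi * t) = 0 := by linarith
  have h4 : Real.sin (Real.pi * t) = 2 * ((n - j : ℤ) : ℝ) := by push_cast; linarith
  have h5 := Real.sin_sq_add_cos_sq (Real.pi * t)
  rw [h3, h4] at h5
  have h6 : 4 * (n - j) ^ 2 = 1 := by
    have : (4 * ((n - j : ℤ) : ℝ) ^ 2) = 1 := by linarith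
    exact_mod_cast this
  omega

/-- The base point of the `j`-th meridian loop. -/
def meridianBase (j : ℤ) : Regular := ⟨proj (meridianLift j 0), meridianLift_regular j 0⟩

/-- The meridian loop of the `j`-th cone axis.  It is the image of a half circle in the plane
`{Re z = 0}`, which crosses the axis at right angles in `(0, j)`; the end points of the half circle are exchanged by the
rotation `(z, u) ↦ (conj z, 2j - u)`, so that the image winds exactly once around the axis. -/
def meridian (j : ℤ) : Path (meridianBase j) (meridianBase j) where
  toFun t := ⟨proj (meridianLift j t), meridianLift_regular j t⟩
  continuous_toFun :=
    (continuous_proj.comp ((continuous_meridianLift j).comp continuous_subtype_val)).subtype_mk _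
  source' := by simp [meridianBase]
  target' := by
    refine Subtype.ext (Quotient.sound (s := dihedralSetoid) ⟨j, Or.inr ⟨?_, ?_⟩⟩)
    · simp only [meridianLift, map_mul, Complex.conj_ofReal, Complex.conj_I, Set.Icc.coe_one,
        mul_one, mul_zero, Real.cos_pi, Real.cos_zero]
      push_cast
      ring
    · simp [meridianLift]; ring

/-- The cubes of the meridians of the two cone axes, carried to the base point `x` along
arbitrary paths: the relators that make the axes cone axes of order 3. -/
def coneRelators (x : Regular) : Set (FundamentalGroup Regular x) :=
  {g | ∃ j : ℤ, (j = 0 ∨ j = 1) ∧ ∃ d : Path x (meridianBase j),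
    g = (FundamentalGroup.fromPath
      (Path.Homotopic.Quotient.mk ((d.trans (meridian j)).trans d.symm))) ^ 3}

/-- The fundamental group `π₁(S)` of the orbifold `S` with cone angle `2π/3` along both axes: the
fundamental group of the regular part modulo the cubes of the meridians of the axes. -/
abbrev OrbifoldPi1 (x : Regular) : Type :=
  FundamentalGroup Regular x ⧸ Subgroup.normalClosure (coneRelators x)

/-- The class in `π₁(S)` of a loop in the regular part. -/
def orbifoldClass {x : Regular} (α : Path x x) : OrbifoldPi1 x :=
  QuotientGroup.mk (FundamentalGroup.fromPath (Path.Homotopic.Quotient.mk α))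

/-- Two loops in the regular part are (freely) homotopic in the orbifold `S` when, after transport
along a path between their base points, they represent the same element of `π₁(S)`. -/
def OrbifoldHomotopic {x y : Regular} (α : Path x x) (β : Path y y) : Prop :=
  ∃ c : Path x y, orbifoldClass α = orbifoldClass ((c.trans β).trans c.symm)

/-- Homotopy in `S` of the unoriented curves underlying two loops on the punctured boundary. -/
def HomotopicInS {x y : PuncturedBoundary} (α : Path x x) (β : Path y y) : Prop :=
  OrbifoldHomotopic (α.map continuous_inclusion) (β.map continuous_inclusion) ∨
    OrbifoldHomotopic (α.map continuous_inclusion) (β.symm.map continuous_inclusion)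

/-! ## The curves of rational slope

The plane covers `∂S` by `(u, v) ↦ [(exp (iπv), u)]`.  This is the quotient of the plane by the
group generated by the rotations by `π` about the integer lattice points, the lattice points lie
over the four cone points, and the rectangle `[0, 1] × [0, 2]` is a fundamental domain.  The
vertical line `u = 1/2` covers the meridian `∂m`. -/

/-- The point `(exp (iπv), u)` of the cylinder. -/
def planeLift (u v : ℝ) : Cylinder :=
  ⟨(Complex.exp (((Real.pi * v : ℝ) : ℂ) * Complex.I), u),
    (Complex.norm_exp_ofReal_mul_I _).le⟩

lemma continuous_planeLift : Continuous fun x : ℝ × ℝ => planeLift x.1 x.2 := by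
  unfold planeLift; fun_prop

lemma planeLift_regular {u v : ℝ} (h : ¬((∃ m : ℤ, u = m) ∧ ∃ n : ℤ, v = n)) :
    proj (planeLift u v) ∉ singularLocus := by
  apply proj_notMem_singularLocus
  rintro ⟨h1, hu⟩
  rw [planeLift, Complex.exp_ofReal_mul_I_im, Real.sin_eq_zero_iff] at h1
  obtain ⟨n, hn⟩ := h1
  refine h ⟨hu, n, ?_⟩
  have := Real.pi_pos
  have h2 : Real.pi * (v - n) = 0 := by linarith
  rcases mul_eq_zero.mp h2 with h3 | h3 <;> linarith

/-- The covering of the punctured boundary by the plane minus the integer lattice. -/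
def planePoint (u v : ℝ) (h : ¬((∃ m : ℤ, u = m) ∧ ∃ n : ℤ, v = n)) : PuncturedBoundary :=
  ⟨proj (planeLift u v),
    ⟨planeLift u v, Complex.norm_exp_ofReal_mul_I _, rfl⟩, planeLift_regular h⟩

/-- The primitive integer direction `(q, p)` of the lines of slope `p / q` in the plane, where
`p / q` is in lowest terms with `q ≥ 0`, and `∞ = 1 / 0`. -/
def direction (r : OnePoint ℚ) : ℤ × ℤ := OnePoint.elim r (0, 1) fun s => (s.den, s.num)

/-- The line of slope `r` through `(a, b)` contains no integer lattice point. -/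
def MissesLattice (r : OnePoint ℚ) (a b : ℝ) : Prop :=
  ∀ t : ℝ, ¬((∃ m : ℤ, a + 2 * (direction r).1 * t = m) ∧
    ∃ n : ℤ, b + 2 * (direction r).2 * t = n)

/-- The simple closed curve on the punctured boundary covered by the line of slope `r = p / q`
through `(a, b)`: the image of the segment from `(a, b)` to `(a + 2q, b + 2p)`. -/
def lineLoop (r : OnePoint ℚ) (a b : ℝ) (h : MissesLattice r a b) :
    Path (planePoint _ _ (h 0)) (planePoint _ _ (h 0)) where
  toFun t := planePoint _ _ (h t)
  continuous_toFun := by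
    refine Continuous.subtype_mk (continuous_proj.comp (continuous_planeLift.comp
      (f := fun t : unitInterval => ((a + 2 * (direction r).1 * (t : ℝ),
        b + 2 * (direction r).2 * (t : ℝ)) : ℝ × ℝ)) ?_)) _
    fun_prop
  source' := by simp
  target' := by
    refine Subtype.ext (Quotient.sound (s := dihedralSetoid) ⟨-(direction r).1, Or.inl ⟨?_, ?_⟩⟩)
    · refine Complex.exp_eq_exp_iff_exists_int.mpr ⟨-(direction r).2, ?_⟩
      simp only [Set.Icc.coe_one]
      push_cast
      ring
    · simp [planeLift]

/-- `IsGamma r α` says that, as an unoriented curve, the loop `α` on the punctured boundary belongs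
to the homotopy class `γ_r`, the class on `∂S` (minus the cone points) of the curves covered by
the lines of slope `r` that miss the lattice. -/
def IsGamma (r : OnePoint ℚ) {x : PuncturedBoundary} (α : Path x x) : Prop :=
  ∃ (a b : ℝ) (h : MissesLattice r a b),
    FreelyHomotopic α (lineLoop r a b h) ∨ FreelyHomotopic α (lineLoop r a b h).symm

end ConedBall

end

/-!
Every curve of slope `p / q` becomes, in the regular part of `S`, the graph of a function of the
coordinate `u`: the coordinate `Re z` of the cylinder can be contracted, and the line of slope
`p / q` leaves the sine curve `Im z = sin (π (β + p u / q))` over one period `2q`. The free homotopy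
class of a graph depends only on the sides on which it passes the axes, that is, on the signs of the
function at the integers (`freelyHomotopic_graphLoop_of_sign`).

If `p / q` changes by an even integer, the signs do not change at all; for `-p / q` one uses
`sin (π - x) = sin x`. The parameter `β` matters only through the integer `⌊q β⌋`. Translations by
even lattice vectors change it by an arbitrary even integer, and reversing the curve changes its
parity, so that the unoriented curve depends on the slope alone
(`unorientedHomotopic_sinProfile`). This proves that slopes `± p / q + 2k` give homotopic curves.

For the converse, the function `cos (π (u + i Im z))` maps the regular part to `ℂ ∖ {1, -1}`. Over
its target there is an explicit principal bundle with discrete fibre `G` for any two elements `A`,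
`B` of a group `G` (`coneBundle`), and parallel transport in it turns loops into elements of `G`.
The meridians go to `A⁻¹` and `B⁻¹`, so that for `A ^ 3 = B ^ 3 = 1` the conjugacy class of the
transport is an invariant of homotopy in `S` (`OrbifoldHomotopic.isConj_transport`). A graph goes to
the product of the letters `A ^ (± 1)`, `B ^ (± 1)` of the axes that it passes
(`transport_graphLoop`).

Finally, `G` is taken to be a group of permutations of the vertices of the Bass-Serre tree of
`ℤ/3 * ℤ/3`, written as words, which contains the two generators of order three. Each of its
elements changes the length and the number of sign changes of a word by a bounded amount, so that
the rates at which its powers change these two numbers are conjugacy invariants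
(`HasRates.eq_of_isConj`).
After a reduction to `0 ≤ p / q ≤ 1`, the curve of slope `p / q` has the rates `2q` and `2p`: each
period of the line passes `2q` axes, and the sign changes whenever the line passes one of `2p`
integers (`hasRates_transport`). Hence the curve determines `p / q` up to a sign and an even
integer.
-/

noncomputable section

namespace ConedBall

/-! ### Free homotopy of loops -/

section FreeHomotopy

variable {X Y : Type*} [TopologicalSpace X] [TopologicalSpace Y]

/-- Free homotopy as an intertwining relation: the form in which it composes. -/
lemma freelyHomotopic_iff {x y : X} {α : Path x x} {β : Path y y} :
    FreelyHomotopic α β ↔ ∃ c : Path.Homotopic.Quotient x y,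
      (Path.Homotopic.Quotient.mk α).trans c = c.trans (Path.Homotopic.Quotient.mk β) := by
  constructor
  · rintro ⟨c, h⟩
    refine ⟨Path.Homotopic.Quotient.mk c, ?_⟩
    rw [Path.Homotopic.Quotient.eq.mpr h]
    simp
  · rintro ⟨c, h⟩
    induction c using Path.Homotopic.Quotient.ind with | mk c =>
    refine ⟨c, Path.Homotopic.Quotient.eq.mp ?_⟩
    simp only [Path.Homotopic.Quotient.mk_trans, Path.Homotopic.Quotient.mk_symm, ← h]
    simp

lemma FreelyHomotopic.trans {x y z : X} {α : Path x x} {β : Path y y} {γ : Path z z}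
    (h : FreelyHomotopic α β) (h' : FreelyHomotopic β γ) : FreelyHomotopic α γ := by
  obtain ⟨c, hc⟩ := freelyHomotopic_iff.mp h
  obtain ⟨d, hd⟩ := freelyHomotopic_iff.mp h'
  refine freelyHomotopic_iff.mpr ⟨c.trans d, ?_⟩
  rw [← Path.Homotopic.Quotient.trans_assoc, hc, Path.Homotopic.Quotient.trans_assoc, hd,
    Path.Homotopic.Quotient.trans_assoc]

lemma FreelyHomotopic.symm {x y : X} {α : Path x x} {β : Path y y}
    (h : FreelyHomotopic α β) : FreelyHomotopic β α := by
  obtain ⟨c, hc⟩ := freelyHomotopic_iff.mp h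
  refine freelyHomotopic_iff.mpr ⟨c.symm, ?_⟩
  calc _ = c.symm.trans ((c.trans (Path.Homotopic.Quotient.mk β)).trans c.symm) := by
        simp only [← Path.Homotopic.Quotient.trans_assoc]; simp
    _ = _ := by rw [← hc]; simp

lemma FreelyHomotopic.reverse {x y : X} {α : Path x x} {β : Path y y}
    (h : FreelyHomotopic α β) : FreelyHomotopic α.symm β.symm := by
  obtain ⟨c, hc⟩ := h
  refine ⟨c, Path.Homotopic.Quotient.eq.mp ?_⟩
  have := Path.Homotopic.Quotient.eq.mpr hc.symm₂
  rw [this]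
  simp only [Path.trans_symm, Path.symm_symm, Path.Homotopic.Quotient.mk_trans,
    Path.Homotopic.Quotient.trans_assoc]

lemma FreelyHomotopic.map {x y : X} {α : Path x x} {β : Path y y}
    (h : FreelyHomotopic α β) {f : X → Y} (hf : Continuous f) :
    FreelyHomotopic (α.map hf) (β.map hf) := by
  obtain ⟨c, hc⟩ := h
  refine ⟨c.map hf, ?_⟩
  have := hc.map ⟨f, hf⟩
  simpa [Path.map_trans, Path.map_symm] using this

/-- A homotopy through closed curves is a free homotopy: the two ways around the boundary of the
square are homotopic, because the plane is simply connected. -/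
lemma freelyHomotopic_of_square {x y : X} {α : Path x x} {β : Path y y}
    (H : unitInterval × ℝ → X) (hH : Continuous H) (h0 : ∀ t : unitInterval, H (0, t) = α t)
    (h1 : ∀ t : unitInterval, H (1, t) = β t) (hc : ∀ s, H (s, 0) = H (s, 1)) :
    FreelyHomotopic α β := by
  -- The homotopy is extended to the whole plane, whose simple connectedness is an instance.
  let K : ℝ × ℝ → X := fun p => H (Set.projIcc 0 1 zero_le_one p.1, p.2)
  have hK : Continuous K := hH.comp ((continuous_projIcc.comp continuous_fst).prodMk continuous_snd)
  have k0 : ∀ t : unitInterval, K (0, t) = α t := fun t => by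
    simpa [K] using h0 t
  have k1 : ∀ t : unitInterval, K (1, t) = β t := fun t => by
    simpa [K] using h1 t
  have kc : ∀ s : ℝ, K (s, 0) = K (s, 1) := fun s => hc _
  have hx0 : x = K (0, 0) := by simpa using (k0 0).symm
  have hy0 : y = K (1, 0) := by simpa using (k1 0).symm
  have hy1 : y = K (1, 1) := by simpa using (k1 1).symm
  have key : Path.Homotopic
      ((Path.segment ((0, 0) : ℝ × ℝ) (0, 1)).trans (Path.segment (0, 1) (1, 1)))
      ((Path.segment (0, 0) (1, 0)).trans (Path.segment (1, 0) (1, 1))) :=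
    SimplyConnectedSpace.paths_homotopic _ _
  have key' := (key.map ⟨K, hK⟩).pathCast hx0 hy1
  let c : Path x y := ((Path.segment ((0, 0) : ℝ × ℝ) (1, 0)).map hK).cast hx0 hy0
  refine freelyHomotopic_iff.mpr ⟨.mk c, ?_⟩
  rw [← Path.Homotopic.Quotient.mk_trans, ← Path.Homotopic.Quotient.mk_trans]
  refine Path.Homotopic.Quotient.eq.mpr ?_
  convert! key' using 1
  · ext t
    simp only [Path.map_coe, Path.cast_coe, Function.comp_apply, Path.trans_apply,
      ContinuousMap.coe_mk]
    split_ifs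
    · rw [← k0]
      simp [AffineMap.lineMap_apply]
    · simp [c, AffineMap.lineMap_apply, kc]
  · ext t
    simp only [Path.map_coe, Path.cast_coe, Function.comp_apply, Path.trans_apply,
      ContinuousMap.coe_mk]
    split_ifs
    · simp [c, AffineMap.lineMap_apply]
    · rw [← k1]
      simp [AffineMap.lineMap_apply]

end FreeHomotopy

/-! ### Curves that are graphs over the axis of the cylinder -/

/-- The image in the regular part of a point of the cylinder off the axes. -/
def regularPoint (z : ℂ) (u : ℝ) (hz : ‖z‖ ≤ 1) (h : ¬(z.im = 0 ∧ ∃ n : ℤ, u = n)) : Regular :=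
  ⟨proj ⟨(z, u), hz⟩, proj_notMem_singularLocus h⟩

lemma continuous_regularPoint {P : Type*} [TopologicalSpace P] {z : P → ℂ} {u : P → ℝ}
    (hz : Continuous z) (hu : Continuous u) (h1 : ∀ p, ‖z p‖ ≤ 1)
    (h2 : ∀ p, ¬((z p).im = 0 ∧ ∃ n : ℤ, u p = n)) :
    Continuous fun p => regularPoint (z p) (u p) (h1 p) (h2 p) :=
  (continuous_proj.comp ((hz.prodMk hu).subtype_mk _)).subtype_mk _

lemma regularPoint_eq_of_translate {z z' : ℂ} {u u' : ℝ} {hz hz' h h'} (k : ℤ) (e : z' = z)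
    (e' : u' = u + 2 * k) : regularPoint z u hz h = regularPoint z' u' hz' h' :=
  Subtype.ext (Quotient.sound (s := dihedralSetoid) ⟨k, Or.inl ⟨e, e'⟩⟩)

lemma regularPoint_congr {z z' : ℂ} {u u' : ℝ} {hz hz' h h'} (e : z = z') (e' : u = u') :
    regularPoint z u hz h = regularPoint z' u' hz' h' := by
  subst e e'; rfl

lemma regularPoint_eq_of_rotate {z z' : ℂ} {u u' : ℝ} {hz hz' h h'} (k : ℤ) (e : z' = conj z)
    (e' : u' = -u + 2 * k) : regularPoint z u hz h = regularPoint z' u' hz' h' :=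
  Subtype.ext (Quotient.sound (s := dihedralSetoid) ⟨k, Or.inr ⟨e, e'⟩⟩)

/-- A function whose graph `Im z = y u` in the slice `Re z = 0` of the cylinder misses the axes and
closes up in `S` after an increment `2q` of `u`. -/
structure Profile (q : ℕ) where
  /-- The height of the graph. -/
  toFun : ℝ → ℝ
  continuous' : Continuous toFun
  abs_le' : ∀ u, |toFun u| ≤ 1
  periodic' : ∀ u, toFun (u + 2 * q) = toFun u
  ne_zero' : ∀ n : ℤ, toFun n ≠ 0

variable {q : ℕ}

instance : CoeFun (Profile q) fun _ => ℝ → ℝ := ⟨Profile.toFun⟩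

lemma norm_ofReal_mul_I_le {x : ℝ} (h : |x| ≤ 1) : ‖(x : ℂ) * Complex.I‖ ≤ 1 := by
  simpa using h

/-- The point of the graph of `y` over `u`. -/
def graphPoint (y : Profile q) (u : ℝ) : Regular :=
  regularPoint (y u * Complex.I) u (norm_ofReal_mul_I_le (y.abs_le' u)) (by
    rintro ⟨h, n, rfl⟩
    exact y.ne_zero' n (by simpa using h))

lemma continuous_graphPoint (y : Profile q) : Continuous (graphPoint y) := by
  have := y.continuous'
  exact continuous_regularPoint (by fun_prop) continuous_id _ _

lemma graphPoint_add_period (y : Profile q) (u : ℝ) :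
    graphPoint y (u + 2 * q) = graphPoint y u :=
  (regularPoint_eq_of_translate q (by rw [y.periodic']) (by simp)).symm

/-- The loop covered by one period of the graph of `y`, starting over `a`. -/
def graphLoop (y : Profile q) (a : ℝ) : Path (graphPoint y a) (graphPoint y a) where
  toFun t := graphPoint y (a + 2 * q * t)
  continuous_toFun := (continuous_graphPoint y).comp (by fun_prop)
  source' := by simp
  target' := by simp [graphPoint_add_period]

lemma graphLoop_apply (y : Profile q) (a : ℝ) (t : unitInterval) :
    graphLoop y a t = graphPoint y (a + 2 * q * t) := rfl

/-- The free homotopy class of a graph does not depend on the starting point. -/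
lemma freelyHomotopic_graphLoop_of_eq {x : Regular} {α : Path x x} (y : Profile q) (a b : ℝ)
    (h : ∀ t : unitInterval, α t = graphPoint y (a + 2 * q * t)) :
    FreelyHomotopic α (graphLoop y b) := by
  refine freelyHomotopic_of_square
    (fun p => graphPoint y ((1 - p.1) * a + p.1 * b + 2 * q * p.2))
    ((continuous_graphPoint y).comp (by fun_prop)) ?_ ?_ ?_
  · intro t; simp [h]
  · intro t; simp [graphLoop_apply]
  · intro s; simp [graphPoint_add_period]

lemma freelyHomotopic_graphLoop_base (y : Profile q) (a b : ℝ) :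
    FreelyHomotopic (graphLoop y a) (graphLoop y b) :=
  freelyHomotopic_graphLoop_of_eq y a b fun _ => rfl

lemma freelyHomotopic_graphLoop_shift {y y' : Profile q} (k : ℤ) (h : ∀ u, y' u = y (u + 2 * k))
    (a b : ℝ) : FreelyHomotopic (graphLoop y' a) (graphLoop y b) :=
  freelyHomotopic_graphLoop_of_eq y (a + 2 * k) b fun t =>
    (by
      rw [graphLoop_apply]
      exact regularPoint_eq_of_translate k (by rw [h]; ring_nf) (by ring))

/-- The rotation `(z, u) ↦ (conj z, -u)` shows that the reversed curve is again a graph. -/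
lemma freelyHomotopic_graphLoop_symm {y y' : Profile q} (h : ∀ u, y' u = -y (-u)) (a b : ℝ) :
    FreelyHomotopic (graphLoop y a).symm (graphLoop y' b) := by
  refine freelyHomotopic_graphLoop_of_eq y' (-a - 2 * q) b fun t => ?_
  rw [Path.symm_apply, Function.comp_apply, graphLoop_apply]
  refine regularPoint_eq_of_rotate 0 ?_ ?_
  · rw [h]
    simp only [unitInterval.coe_symm_eq, map_mul, Complex.conj_ofReal, Complex.conj_I,
      Complex.ofReal_neg, neg_mul, mul_neg]
    ring_nf
  · simp; ring

/-- Only the signs of the heights over the integers, that is, the sides on which the axes are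
passed, matter for the free homotopy class of a graph. -/
lemma freelyHomotopic_graphLoop_of_sign {y y' : Profile q}
    (h : ∀ n : ℤ, 0 < y n ↔ 0 < y' n) (a b : ℝ) :
    FreelyHomotopic (graphLoop y a) (graphLoop y' b) := by
  refine FreelyHomotopic.trans ?_ (freelyHomotopic_graphLoop_base y' a b)
  have hy := y.continuous'
  have hy' := y'.continuous'
  let z : unitInterval × ℝ → ℂ := fun p =>
    (((1 - p.1) * y (a + 2 * q * p.2) + p.1 * y' (a + 2 * q * p.2) : ℝ) : ℂ) * Complex.I
  have hz : ∀ p, ‖z p‖ ≤ 1 := by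
    intro p
    apply norm_ofReal_mul_I_le
    have h1 := abs_le.mp (y.abs_le' (a + 2 * q * p.2))
    have h2 := abs_le.mp (y'.abs_le' (a + 2 * q * p.2))
    have h3 := p.1.2.1
    have h4 := p.1.2.2
    rw [abs_le]
    constructor <;> nlinarith
  have hr : ∀ p : unitInterval × ℝ, ¬((z p).im = 0 ∧ ∃ n : ℤ, a + 2 * q * p.2 = n) := by
    rintro p ⟨h1, n, hn⟩
    simp only [z] at h1
    rw [hn] at h1
    simp only [Complex.mul_im, Complex.ofReal_re, Complex.I_im, mul_one, Complex.ofReal_im,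
      Complex.I_re, mul_zero, add_zero] at h1
    have h3 := p.1.2.1
    have h4 := p.1.2.2
    have e1 := y.ne_zero' n
    have e2 := y'.ne_zero' n
    have hn := h n
    rcases lt_or_gt_of_ne e1 with g1 | g1
    · have g2 : y' n < 0 := lt_of_le_of_ne (not_lt.mp fun hh => absurd (hn.mpr hh) g1.not_gt) e2
      rcases h3.eq_or_lt with h5 | h5
      · rw [← h5] at h1; simp at h1; exact e1 h1
      · nlinarith [mul_nonneg (sub_nonneg.mpr h4) (neg_nonneg.mpr g1.le),
          mul_pos h5 (neg_pos.mpr g2)]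
    · have g2 := hn.mp g1
      rcases h3.eq_or_lt with h5 | h5
      · rw [← h5] at h1; simp at h1; exact e1 h1
      · nlinarith [mul_nonneg (sub_nonneg.mpr h4) g1.le, mul_pos h5 g2]
  refine freelyHomotopic_of_square (fun p => regularPoint (z p) (a + 2 * q * p.2) (hz p) (hr p))
    (continuous_regularPoint (by fun_prop) (by fun_prop) hz hr) ?_ ?_ ?_
  · intro t
    rw [graphLoop_apply]
    exact regularPoint_congr (by simp [z]) rfl
  · intro t
    rw [graphLoop_apply]
    exact regularPoint_congr (by simp [z]) rfl
  · intro s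
    refine regularPoint_eq_of_translate q ?_ (by push_cast; ring)
    simp [z, y.periodic', y'.periodic']

/-! ### The curves of rational slope as graphs -/

/-- The sine curve cut out of the slice `Re z = 0` by the line of slope `ρ` through `(0, β)`. -/
def sinProfile (q : ℕ) (ρ β : ℝ) (hq : ∃ m : ℤ, q * ρ = m) (h : ∀ n m : ℤ, β + ρ * n ≠ m) :
    Profile q where
  toFun u := Real.sin (Real.pi * (β + ρ * u))
  continuous' := by fun_prop
  abs_le' u := Real.abs_sin_le_one _
  periodic' u := by
    obtain ⟨m, hm⟩ := hq
    have : Real.pi * (β + ρ * (u + 2 * q)) = Real.pi * (β + ρ * u) + m * (2 * Real.pi) := by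
      rw [← hm]; ring
    rw [this, Real.sin_add_int_mul_two_pi]
  ne_zero' n := by
    rw [Ne, Real.sin_eq_zero_iff]
    rintro ⟨m, hm⟩
    refine h n m ?_
    have := Real.pi_pos
    have h2 : Real.pi * (β + ρ * n - m) = 0 := by linarith
    rcases mul_eq_zero.mp h2 with h3 | h3 <;> linarith

@[simp] lemma sinProfile_apply (q : ℕ) (ρ β : ℝ) (hq h) (u : ℝ) :
    sinProfile q ρ β hq h u = Real.sin (Real.pi * (β + ρ * u)) := rfl

lemma direction_infty : direction ∞ = (0, 1) := rfl

lemma direction_coe (s : ℚ) : direction s = ((s.den : ℤ), s.num) := rfl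

/-- The coordinate `Re z` of a curve of finite slope can be contracted, which makes it a graph. -/
lemma exists_sinProfile_of_lineLoop_coe (s : ℚ) (a b : ℝ) (h : MissesLattice s a b) :
    ∃ (β : ℝ) (hq : ∃ m : ℤ, (s.den : ℝ) * (s : ℝ) = m) (hβ : ∀ n m : ℤ, β + s * n ≠ m),
      FreelyHomotopic ((lineLoop s a b h).map continuous_inclusion)
        (graphLoop (sinProfile s.den s β hq hβ) a) := by
  have hden : (s.den : ℝ) ≠ 0 := by exact_mod_cast s.den_ne_zero
  have hs : (s.den : ℝ) * (s : ℝ) = s.num := by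
    rw [mul_comm]; exact_mod_cast s.mul_den_eq_num
  have hs' : (s : ℝ) = s.num / s.den := by rw [← hs]; field_simp
  refine ⟨b - s * a, ⟨s.num, hs⟩, ?_, ?_⟩
  · intro n m e
    refine h ((n - a) / (2 * s.den)) ⟨⟨n, ?_⟩, ⟨m, ?_⟩⟩
    · change a + 2 * ((s.den : ℤ) : ℝ) * _ = _
      push_cast; field_simp; ring
    · change b + 2 * (s.num : ℝ) * _ = _
      rw [← e, hs']; field_simp; ring
  · let z : unitInterval × ℝ → ℂ := fun p =>
      (1 - p.1 : ℝ) * Complex.exp (((Real.pi * (b + 2 * s.num * p.2) : ℝ) : ℂ) * Complex.I) +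
        ((p.1 * Real.sin (Real.pi * (b + 2 * s.num * p.2)) : ℝ) : ℂ) * Complex.I
    have hz : ∀ p, ‖z p‖ ≤ 1 := by
      intro p
      have h3 := p.1.2.1
      have h4 := p.1.2.2
      refine (norm_add_le _ _).trans ?_
      have h5 : ‖((p.1 * Real.sin (Real.pi * (b + 2 * s.num * p.2)) : ℝ) : ℂ) * Complex.I‖
          ≤ (p.1 : ℝ) := by
        simp only [norm_mul, Complex.norm_I, mul_one, Complex.norm_real, Real.norm_eq_abs]
        rw [abs_of_nonneg h3]
        exact mul_le_of_le_one_right h3 (Real.abs_sin_le_one _)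
      rw [norm_mul, Complex.norm_exp_ofReal_mul_I, Complex.norm_real, Real.norm_eq_abs,
        abs_of_nonneg (by linarith)]
      linarith
    have hr : ∀ p : unitInterval × ℝ,
        ¬((z p).im = 0 ∧ ∃ n : ℤ, a + 2 * s.den * p.2 = n) := by
      rintro p ⟨h1, n, hn⟩
      have h2 : Real.sin (Real.pi * (b + 2 * s.num * p.2)) = 0 := by
        rw [Complex.add_im, Complex.im_ofReal_mul, Complex.exp_ofReal_mul_I_im,
          Complex.im_ofReal_mul, Complex.I_im] at h1
        linarith
      obtain ⟨m, hm⟩ := Real.sin_eq_zero_iff.mp h2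
      refine h p.2 ⟨⟨n, hn⟩, ⟨m, ?_⟩⟩
      have := Real.pi_pos
      have h3 : Real.pi * (b + 2 * s.num * p.2 - m) = 0 := by linarith
      rcases mul_eq_zero.mp h3 with h4 | h4
      · linarith
      · change b + 2 * (s.num : ℝ) * _ = _
        linarith
    refine freelyHomotopic_of_square
      (fun p => regularPoint (z p) (a + 2 * s.den * p.2) (hz p) (hr p))
      (continuous_regularPoint (by fun_prop) (by fun_prop) hz hr) ?_ ?_ ?_
    · intro t
      refine Subtype.ext (congrArg proj (Subtype.ext (Prod.ext ?_ ?_))) <;>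
        simp [z, planeLift, direction_coe]
    · intro t
      rw [graphLoop_apply]
      refine regularPoint_congr ?_ rfl
      simp only [sinProfile_apply]
      have e : b - s * a + s * (a + 2 * s.den * t) = b + 2 * s.num * t := by
        rw [← hs]; ring
      rw [e]
      simp [z]
    · intro t
      refine regularPoint_eq_of_translate s.den ?_ ?_
      · have e : Real.pi * (b + 2 * s.num * 1) = Real.pi * b + s.num * (2 * Real.pi) := by ring
        have e' : Complex.exp (((Real.pi * b + s.num * (2 * Real.pi) : ℝ) : ℂ) * Complex.I) =
            Complex.exp (((Real.pi * b : ℝ) : ℂ) * Complex.I) :=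
          Complex.exp_eq_exp_iff_exists_int.mpr ⟨s.num, by push_cast; ring⟩
        simp only [z, e, e', Real.sin_add_int_mul_two_pi, mul_zero, add_zero]
      · push_cast; ring

lemma lineLoop_infty (a b a' : ℝ) (h : MissesLattice ∞ a b) :
    ∃ hq hβ,
      FreelyHomotopic ((lineLoop ∞ a b h).map continuous_inclusion)
        (graphLoop (sinProfile 0 0 (1 / 2) hq hβ) a') := by
  have ha : ¬ ∃ n : ℤ, a = n := by
    rintro ⟨n, hn⟩
    refine h (-b / 2) ⟨⟨n, ?_⟩, 0, ?_⟩
    · simp [direction_infty, hn]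
    · simp [direction_infty]; ring
  refine ⟨⟨0, by simp⟩, ?_, ?_⟩
  · intro n m e
    have : (1 : ℝ) = 2 * m := by linarith
    have : (1 : ℤ) = 2 * m := by exact_mod_cast this
    omega
  refine FreelyHomotopic.trans ?_ (freelyHomotopic_graphLoop_base _ a a')
  let z : unitInterval × ℝ → ℂ := fun p =>
    (1 - p.1 : ℝ) * Complex.exp (((Real.pi * (b + 2 * p.2) : ℝ) : ℂ) * Complex.I) +
      ((p.1 : ℝ) : ℂ) * Complex.I
  have hz : ∀ p, ‖z p‖ ≤ 1 := by
    intro p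
    have h3 := p.1.2.1
    have h4 := p.1.2.2
    refine (norm_add_le _ _).trans ?_
    rw [norm_mul, norm_mul, Complex.norm_exp_ofReal_mul_I, Complex.norm_real, Real.norm_eq_abs,
      abs_of_nonneg (by linarith), Complex.norm_real, Real.norm_eq_abs, abs_of_nonneg h3,
      Complex.norm_I]
    linarith
  refine freelyHomotopic_of_square (fun p => regularPoint (z p) a (hz p) fun h => ha h.2)
    (continuous_regularPoint (by fun_prop) continuous_const hz _) ?_ ?_ ?_
  · intro t
    refine Subtype.ext (congrArg proj (Subtype.ext (Prod.ext ?_ ?_))) <;>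
      simp [z, planeLift, direction_infty]
  · intro t
    rw [graphLoop_apply]
    refine regularPoint_congr ?_ ?_
    · have e : Real.pi * (1 / 2 + 0 * (a + 2 * ((0 : ℕ) : ℝ) * t)) = Real.pi / 2 := by ring
      simp only [sinProfile_apply, e, Real.sin_pi_div_two]
      simp [z]
    · simp
  · intro s
    refine regularPoint_congr ?_ rfl
    simp only [z]
    congr 2
    refine Eq.symm ?_
    refine Complex.exp_eq_exp_iff_exists_int.mpr ⟨1, ?_⟩
    push_cast; ring

/-! ### Classification of the sine curves by their slopes -/

/-- Two loops that are freely homotopic as unoriented curves. -/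
def UnorientedHomotopic {X : Type*} [TopologicalSpace X] {x y : X} (α : Path x x) (β : Path y y) :
    Prop :=
  FreelyHomotopic α β ∨ FreelyHomotopic α β.symm

section Unoriented

variable {X : Type*} [TopologicalSpace X] {x y z : X} {α : Path x x} {β : Path y y} {γ : Path z z}

lemma FreelyHomotopic.unoriented (h : FreelyHomotopic α β) : UnorientedHomotopic α β := Or.inl h

lemma UnorientedHomotopic.symm (h : UnorientedHomotopic α β) : UnorientedHomotopic β α := by
  rcases h with h | h
  · exact Or.inl h.symm
  · have := h.reverse
    rw [Path.symm_symm] at this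
    exact Or.inr this.symm

lemma UnorientedHomotopic.trans (h : UnorientedHomotopic α β) (h' : UnorientedHomotopic β γ) :
    UnorientedHomotopic α γ := by
  rcases h with h | h <;> rcases h' with h' | h'
  · exact Or.inl (h.trans h')
  · exact Or.inr (h.trans h')
  · exact Or.inr (h.trans h'.reverse)
  · have := h'.reverse
    rw [Path.symm_symm] at this
    exact Or.inl (h.trans this)

end Unoriented

lemma sin_pi_mul_pos_iff {x : ℝ} (hx : ∀ m : ℤ, x ≠ m) :
    0 < Real.sin (Real.pi * x) ↔ Even ⌊x⌋ := by
  have h1 : 0 < Int.fract x := lt_of_le_of_ne (Int.fract_nonneg x) fun h =>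
    hx ⌊x⌋ (by have := Int.self_sub_floor x; linarith)
  have h2 := Int.fract_lt_one x
  have h3 : 0 < Real.sin (Real.pi * Int.fract x) := by
    have := Real.pi_pos
    exact Real.sin_pos_of_pos_of_lt_pi (by positivity) (by nlinarith)
  have h4 : Real.pi * x = Real.pi * Int.fract x + ⌊x⌋ * Real.pi := by
    rw [← Int.self_sub_floor]; ring
  rw [h4, Real.sin_add_int_mul_pi]
  rcases Int.even_or_odd ⌊x⌋ with h | h
  · simp [h, h.neg_one_zpow, h3]
  · simp only [h.neg_one_zpow, neg_one_mul, Left.neg_pos_iff, Int.not_even_iff_odd.mpr h, iff_false]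
    linarith

lemma sinProfile_pos_iff {q : ℕ} {ρ β : ℝ} {hq h} (n : ℤ) :
    0 < sinProfile q ρ β hq h n ↔ Even ⌊β + ρ * n⌋ :=
  sin_pi_mul_pos_iff (h n)

/-- The reverse of a sine curve is a sine curve of the same slope. -/
lemma exists_sinProfile_reverse {q : ℕ} {ρ β : ℝ} {hq} {h : ∀ n m : ℤ, β + ρ * n ≠ m} (a b : ℝ) :
    ∃ h', FreelyHomotopic (graphLoop (sinProfile q ρ β hq h) a).symm
      (graphLoop (sinProfile q ρ (-β) hq h') b) := by
  refine ⟨fun n m e => ?_, freelyHomotopic_graphLoop_symm (fun u => ?_) a b⟩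
  · refine h (-n) (-m) ?_
    push_cast; linarith
  · have : Real.pi * (-β + ρ * u) = -(Real.pi * (β + ρ * -u)) := by ring
    rw [sinProfile_apply, sinProfile_apply, this, Real.sin_neg]

section Slope

variable (s : ℚ)

lemma den_mul_self : (s.den : ℝ) * (s : ℝ) = s.num := by
  rw [mul_comm]; exact_mod_cast s.mul_den_eq_num

lemma exists_num_mul_add_den_mul (t : ℤ) : ∃ j l : ℤ, j * s.num + l * s.den = t := by
  have h : IsCoprime s.num (s.den : ℤ) := Rat.isCoprime_num_den s
  obtain ⟨a, b, h⟩ := h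
  exact ⟨t * a, t * b, by linear_combination t * h⟩

lemma floor_add_slope_mul (β : ℝ) (n : ℤ) :
    ⌊β + s * n⌋ = (⌊s.den * β⌋ + s.num * n) / s.den := by
  have hden : (s.den : ℝ) ≠ 0 := by exact_mod_cast s.den_ne_zero
  have : β + s * n = (s.den * β + (s.num * n : ℤ)) / s.den := by
    push_cast
    rw [← den_mul_self]; field_simp
  rw [this, Int.floor_div_natCast, Int.floor_add_intCast]

variable {s}

/-- The line `u ↦ β + s u` hits the lattice as soon as `β` is a multiple of `1 / q`. -/
lemma den_mul_ne_int {β : ℝ} (h : ∀ n m : ℤ, β + s * n ≠ m) (k : ℤ) : s.den * β ≠ k := by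
  intro hk
  have hden : (s.den : ℝ) ≠ 0 := by exact_mod_cast s.den_ne_zero
  obtain ⟨j, l, hjl⟩ := exists_num_mul_add_den_mul s k
  refine h (-j) l (mul_left_cancel₀ hden ?_)
  rw [mul_add, hk, ← mul_assoc, den_mul_self, ← hjl]
  push_cast; ring

/-- Translations of the line by even lattice vectors change `q β` by an arbitrary even integer. -/
lemma freelyHomotopic_of_even {β β' : ℝ} {hq h hq' h'}
    (he : Even (⌊s.den * β'⌋ - ⌊s.den * β⌋)) (a a' : ℝ) :
    FreelyHomotopic (graphLoop (sinProfile s.den s β hq h) a)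
      (graphLoop (sinProfile s.den s β' hq' h') a') := by
  obtain ⟨t, ht⟩ := he
  obtain ⟨j, l, hjl⟩ := exists_num_mul_add_den_mul s t
  have h2 : ∀ n m : ℤ, (β + 2 * j * s + 2 * l) + s * n ≠ m := by
    intro n m e
    refine h (n + 2 * j) (m - 2 * l) ?_
    push_cast; linarith
  have hfl : ⌊s.den * (β + 2 * j * s + 2 * l)⌋ = ⌊s.den * β'⌋ := by
    have : s.den * (β + 2 * j * s + 2 * l) = s.den * β + ((t + t : ℤ) : ℝ) := by
      rw [← hjl]
      push_cast
      rw [← den_mul_self]; ring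
    rw [this, Int.floor_add_intCast, ← ht]; ring
  refine (freelyHomotopic_graphLoop_shift (y := sinProfile s.den s β hq h)
    (y' := sinProfile s.den s (β + 2 * j * s + 2 * l) hq h2) j ?_ a a).symm.trans
    (freelyHomotopic_graphLoop_of_sign ?_ a a')
  · intro u
    have : Real.pi * (β + 2 * j * s + 2 * l + s * u) =
        Real.pi * (β + s * (u + 2 * j)) + l * (2 * Real.pi) := by ring
    rw [sinProfile_apply, sinProfile_apply, this, Real.sin_add_int_mul_two_pi]
  · intro n
    rw [sinProfile_pos_iff, sinProfile_pos_iff, floor_add_slope_mul, floor_add_slope_mul, hfl]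

/-- All lines of the same rational slope cover the same unoriented curve, up to homotopy. -/
lemma unorientedHomotopic_sinProfile {β β' : ℝ} {hq h hq' h'} (a a' : ℝ) :
    UnorientedHomotopic (graphLoop (sinProfile s.den s β hq h) a)
      (graphLoop (sinProfile s.den s β' hq' h') a') := by
  rcases Int.even_or_odd (⌊s.den * β'⌋ - ⌊s.den * β⌋) with he | ho
  · exact Or.inl (freelyHomotopic_of_even he a a')
  · obtain ⟨h2, h3⟩ := exists_sinProfile_reverse (hq := hq) (h := h) a a
    -- Reversal replaces `⌊q β⌋` by `-⌊q β⌋ - 1`, of the other parity.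
    have hfl : ⌊s.den * -β⌋ = -⌊s.den * β⌋ - 1 := by
      rw [Int.floor_eq_iff]
      have h6 := Int.floor_le (s.den * β)
      have h4 := Int.lt_floor_add_one (s.den * β)
      have h5 := lt_of_le_of_ne h6 (den_mul_ne_int h _).symm
      push_cast
      constructor <;> linarith
    have h4 : FreelyHomotopic (graphLoop (sinProfile s.den s (-β) hq h2) a)
        (graphLoop (sinProfile s.den s β' hq' h') a') := by
      refine freelyHomotopic_of_even ?_ a a'
      rw [hfl]
      obtain ⟨t, ht⟩ := ho
      exact ⟨t + 1 + ⌊s.den * β⌋, by linarith⟩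
    exact UnorientedHomotopic.symm (Or.inr (h3.trans h4).symm)

end Slope

section Reduction

variable {q : ℕ} {ρ ρ' β : ℝ} {hq : ∃ m : ℤ, q * ρ = m} {h : ∀ n m : ℤ, β + ρ * n ≠ m}

/-- Full twists along the meridian disk do not change the sides on which the axes are passed. -/
lemma exists_sinProfile_add_even {k : ℤ} (e : ρ' = ρ + 2 * k) (a : ℝ) :
    ∃ hq' h', FreelyHomotopic (graphLoop (sinProfile q ρ β hq h) a)
      (graphLoop (sinProfile q ρ' β hq' h') a) := by
  have key : ∀ n : ℤ, β + ρ' * n = β + ρ * n + ((2 * (k * n) : ℤ) : ℝ) := by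
    intro n; rw [e]; push_cast; ring
  refine ⟨?_, ?_, freelyHomotopic_graphLoop_of_sign (fun n => ?_) a a⟩
  · obtain ⟨m, hm⟩ := hq
    exact ⟨m + 2 * k * q, by rw [e]; push_cast; rw [← hm]; ring⟩
  · intro n m e'
    rw [key] at e'
    exact h n (m - 2 * (k * n)) (by push_cast at e' ⊢; linarith)
  · rw [sinProfile_pos_iff, sinProfile_pos_iff, key, Int.floor_add_intCast, Int.even_add]
    simp

/-- The graph of a sine curve is also the graph of a sine curve of opposite slope, because
`sin (π - x) = sin x`. -/
lemma exists_sinProfile_neg (e : ρ' = -ρ) (a : ℝ) :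
    ∃ hq' h', FreelyHomotopic (graphLoop (sinProfile q ρ β hq h) a)
      (graphLoop (sinProfile q ρ' (1 - β) hq' h') a) := by
  refine ⟨?_, ?_, freelyHomotopic_graphLoop_of_sign (fun n => ?_) a a⟩
  · obtain ⟨m, hm⟩ := hq
    exact ⟨-m, by rw [e]; push_cast; linarith⟩
  · intro n m e'
    exact h n (1 - m) (by rw [e] at e'; push_cast; linarith)
  · have : Real.pi * (1 - β + ρ' * n) = Real.pi - Real.pi * (β + ρ * n) := by rw [e]; ring
    rw [sinProfile_apply, sinProfile_apply, this, Real.sin_pi_sub]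

end Reduction

lemma den_add_two_mul (s : ℚ) (k : ℤ) : (s + 2 * k).den = s.den := by
  have : s + 2 * k = s + ((2 * k : ℤ) : ℚ) := by push_cast; rfl
  rw [this]
  exact Rat.add_intCast_den s _

/-- Slopes that differ by a sign and an even integer belong to homotopic curves. -/
lemma unorientedHomotopic_lineLoop {r r' : OnePoint ℚ} {k : ℤ}
    (e : r' = OnePoint.map (fun s : ℚ => s + 2 * k) r ∨
      r' = OnePoint.map (fun s : ℚ => -s + 2 * k) r) {a b a' b' : ℝ}
    (h : MissesLattice r a b) (h' : MissesLattice r' a' b') :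
    UnorientedHomotopic ((lineLoop r a b h).map continuous_inclusion)
      ((lineLoop r' a' b' h').map continuous_inclusion) := by
  induction r using OnePoint.rec with
  | infty =>
    have e' : r' = ∞ := by rcases e with e | e <;> simpa using e
    subst e'
    obtain ⟨_, _, h1⟩ := lineLoop_infty a b 0 h
    obtain ⟨_, _, h2⟩ := lineLoop_infty a' b' 0 h'
    exact Or.inl (h1.trans h2.symm)
  | coe s =>
    obtain ⟨β, hq, hβ, h1⟩ := exists_sinProfile_of_lineLoop_coe s a b h
    have main : ∀ (t : ℚ) (h' : MissesLattice t a' b') (n : ℕ), t.den = n →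
        (∃ β' hq' hβ' c, FreelyHomotopic ((lineLoop s a b h).map continuous_inclusion)
          (graphLoop (sinProfile n t β' hq' hβ') c)) →
        UnorientedHomotopic ((lineLoop s a b h).map continuous_inclusion)
          ((lineLoop t a' b' h').map continuous_inclusion) := by
      rintro t h' n rfl ⟨β', hq', hβ', c, h2⟩
      obtain ⟨β'', hq'', hβ'', h3⟩ := exists_sinProfile_of_lineLoop_coe t a' b' h'
      exact h2.unoriented.trans ((unorientedHomotopic_sinProfile c a').trans h3.symm.unoriented)
    rcases e with e | e
    · simp only [OnePoint.map_some] at e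
      subst e
      obtain ⟨hq', hβ', h2⟩ := exists_sinProfile_add_even (hq := hq) (h := hβ)
        (ρ' := ((s + 2 * k : ℚ) : ℝ)) (k := k) (by push_cast; rfl) a
      exact main _ h' s.den (den_add_two_mul s k) ⟨β, hq', hβ', a, h1.trans h2⟩
    · simp only [OnePoint.map_some] at e
      subst e
      obtain ⟨hq', hβ', h2⟩ := exists_sinProfile_neg (hq := hq) (h := hβ)
        (ρ' := ((-s : ℚ) : ℝ)) (by push_cast; rfl) a
      obtain ⟨hq'', hβ'', h3⟩ := exists_sinProfile_add_even (hq := hq') (h := hβ')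
        (ρ' := ((-s + 2 * k : ℚ) : ℝ)) (k := k) (by push_cast; rfl) a
      exact main _ h' s.den ((den_add_two_mul (-s) k).trans (Rat.den_neg_eq_den s))
        ⟨1 - β, hq'', hβ'', a, (h1.trans h2).trans h3⟩

lemma OrbifoldHomotopic.of_freelyHomotopic {x y : Regular} {α : Path x x} {β : Path y y}
    (h : FreelyHomotopic α β) : OrbifoldHomotopic α β := by
  obtain ⟨c, hc⟩ := h
  exact ⟨c, congrArg (fun g => (QuotientGroup.mk (FundamentalGroup.fromPath g) : OrbifoldPi1 x))
    (Path.Homotopic.Quotient.eq.mpr hc)⟩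

lemma IsGamma.exists_lineLoop {r : OnePoint ℚ} {x : PuncturedBoundary} {α : Path x x}
    (h : IsGamma r α) : ∃ (a b : ℝ) (h : MissesLattice r a b),
      UnorientedHomotopic (α.map continuous_inclusion)
        ((lineLoop r a b h).map continuous_inclusion) := by
  obtain ⟨a, b, h, h1 | h1⟩ := h
  · exact ⟨a, b, h, Or.inl (h1.map continuous_inclusion)⟩
  · have := h1.map continuous_inclusion
    rw [← Path.map_symm] at this
    exact ⟨a, b, h, Or.inr this⟩

lemma homotopicInS_of_slope {r r' : OnePoint ℚ} {x y : PuncturedBoundary} {γ : Path x x}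
    {γ' : Path y y} (hγ : IsGamma r γ) (hγ' : IsGamma r' γ') {k : ℤ}
    (e : r' = OnePoint.map (fun s : ℚ => s + 2 * k) r ∨
      r' = OnePoint.map (fun s : ℚ => -s + 2 * k) r) : HomotopicInS γ γ' := by
  obtain ⟨a, b, h, h1⟩ := hγ.exists_lineLoop
  obtain ⟨a', b', h', h2⟩ := hγ'.exists_lineLoop
  rcases (h1.trans (unorientedHomotopic_lineLoop e h h')).trans h2.symm with h3 | h3
  · exact Or.inl (.of_freelyHomotopic h3)
  · rw [Path.map_symm] at h3
    exact Or.inr (.of_freelyHomotopic h3)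

/-! ### A map to the twice punctured plane -/

/-- The map `[(z, u)] ↦ cos (π (u + i Im z))` from the regular part of `S` to `ℂ ∖ {1, -1}`. The
dihedral group acts on `u + i Im z` by translations by `2` and by a change of sign, which do not
affect the cosine; the two axes are the preimages of `1` and `-1`. -/
def cosMap (s : Regular) : ℂ :=
  Quotient.lift (fun w : Cylinder => Complex.cos (Real.pi * (w.1.2 + w.1.1.im * Complex.I))) (by
    rintro w w' ⟨k, ⟨h1, h2⟩ | ⟨h1, h2⟩⟩
    · have : (Real.pi * (w'.1.2 + w'.1.1.im * Complex.I) : ℂ) =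
          Real.pi * (w.1.2 + w.1.1.im * Complex.I) + k * (2 * Real.pi) := by
        rw [h1, h2]; push_cast; ring
      simp only [this, Complex.cos_add_int_mul_two_pi]
    · have : (Real.pi * (w'.1.2 + w'.1.1.im * Complex.I) : ℂ) =
          -(Real.pi * (w.1.2 + w.1.1.im * Complex.I)) + k * (2 * Real.pi) := by
        rw [h1, h2, Complex.conj_im]; push_cast; ring
      simp only [this, Complex.cos_add_int_mul_two_pi, Complex.cos_neg]) s.1

lemma continuous_cosMap : Continuous cosMap := by
  refine Continuous.comp (Continuous.quotient_lift ?_ _) continuous_subtype_val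
  fun_prop

section CosMap

variable {z : ℂ} {u : ℝ} {hz : ‖z‖ ≤ 1} {h : ¬(z.im = 0 ∧ ∃ n : ℤ, u = n)}

lemma cosMap_regularPoint : cosMap (regularPoint z u hz h) =
    ((Real.cos (Real.pi * u) * Real.cosh (Real.pi * z.im) : ℝ) : ℂ) +
      ((-(Real.sin (Real.pi * u) * Real.sinh (Real.pi * z.im)) : ℝ) : ℂ) * Complex.I := by
  have : cosMap (regularPoint z u hz h) = Complex.cos (Real.pi * (u + z.im * Complex.I)) := rfl
  rw [this, mul_add, ← mul_assoc, Complex.cos_add_mul_I]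
  push_cast
  ring

lemma cosMap_regularPoint_re : (cosMap (regularPoint z u hz h)).re =
    Real.cos (Real.pi * u) * Real.cosh (Real.pi * z.im) := by
  rw [cosMap_regularPoint, Complex.add_re, Complex.re_ofReal_mul, Complex.ofReal_re, Complex.I_re,
    mul_zero, add_zero]

lemma cosMap_regularPoint_im : (cosMap (regularPoint z u hz h)).im =
    -(Real.sin (Real.pi * u) * Real.sinh (Real.pi * z.im)) := by
  rw [cosMap_regularPoint, Complex.add_im, Complex.im_ofReal_mul, Complex.ofReal_im, Complex.I_im,
    mul_one, zero_add]

end CosMap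

/-- The converse of `proj_notMem_singularLocus`. -/
lemma notMem_axes_of_proj {w : Cylinder} (h : proj w ∉ singularLocus) :
    ¬(w.1.1.im = 0 ∧ ∃ n : ℤ, w.1.2 = n) := by
  rintro ⟨h1, n, hn⟩
  apply h
  rcases Int.even_or_odd' n with ⟨k, rfl | rfl⟩
  · exact Or.inl ⟨⟨(w.1.1, 0), w.2⟩, ⟨h1, by simp⟩,
      Quotient.sound (s := dihedralSetoid) ⟨k, Or.inl ⟨rfl, by rw [hn]; push_cast; ring⟩⟩⟩
  · exact Or.inr ⟨⟨(w.1.1, 1), w.2⟩, ⟨h1, by simp⟩,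
      Quotient.sound (s := dihedralSetoid) ⟨k, Or.inl ⟨rfl, by rw [hn]; push_cast; ring⟩⟩⟩

lemma exists_regularPoint (s : Regular) : ∃ z u hz h, s = regularPoint z u hz h := by
  obtain ⟨s, hs⟩ := s
  obtain ⟨w, rfl⟩ := Quotient.exists_rep s
  exact ⟨w.1.1, w.1.2, w.2, notMem_axes_of_proj hs, rfl⟩

/-- The map `cosMap` omits the values `1` and `-1`. -/
lemma abs_re_cosMap_ne_one (s : Regular) (hs : (cosMap s).im = 0) : |(cosMap s).re| ≠ 1 := by
  obtain ⟨z, u, hz, h, rfl⟩ := exists_regularPoint s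
  rw [cosMap_regularPoint_im, neg_eq_zero, mul_eq_zero] at hs
  rw [cosMap_regularPoint_re, abs_mul, abs_of_pos (Real.cosh_pos _)]
  have hpi := Real.pi_pos
  have hsq := Real.sin_sq_add_cos_sq (Real.pi * u)
  intro e
  by_cases hs0 : Real.sin (Real.pi * u) = 0
  · have hu : ∃ n : ℤ, u = n := by
      obtain ⟨n, hn⟩ := Real.sin_eq_zero_iff.mp hs0
      refine ⟨n, ?_⟩
      have h2 : Real.pi * (u - n) = 0 := by linarith
      rcases mul_eq_zero.mp h2 with h3 | h3 <;> linarith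
    rw [hs0] at hsq
    have hc : |Real.cos (Real.pi * u)| = 1 := by
      rw [← sq_eq_sq₀ (abs_nonneg _) zero_le_one, sq_abs]; linarith
    rw [hc, one_mul] at e
    have : Real.pi * z.im = 0 := by
      by_contra h0
      exact (Real.one_lt_cosh.mpr h0).ne' e
    rcases mul_eq_zero.mp this with h3 | h3
    · linarith
    · exact h ⟨h3, hu⟩
  · have hs1 := hs.resolve_left hs0
    rw [Real.sinh_eq_zero] at hs1
    rw [hs1, Real.cosh_zero, mul_one] at e
    rw [← sq_abs (Real.cos _), e] at hsq
    apply hs0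
    have : Real.sin (Real.pi * u) ^ 2 = 0 := by linarith
    simpa using this

/-! ### A covering of the regular part -/

/-- The three charts of the twice punctured plane: the complements of the two rays
`(-∞, -1] ∪ [1, ∞)`, of the ray `(-∞, 1]`, and of the ray `[-1, ∞)`. -/
inductive Chart
  | mid
  | right
  | left

/-- The part of `Regular` over a chart of the twice punctured plane. -/
def Chart.domain : Chart → Set Regular
  | mid => {s | (cosMap s).im ≠ 0 ∨ |(cosMap s).re| < 1}
  | right => {s | (cosMap s).im ≠ 0 ∨ 1 < (cosMap s).re}
  | left => {s | (cosMap s).im ≠ 0 ∨ (cosMap s).re < -1}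

lemma Chart.isOpen_domain (i : Chart) : IsOpen i.domain := by
  have h := continuous_cosMap
  have him : IsOpen {s : Regular | (cosMap s).im ≠ 0} :=
    isOpen_ne_fun (Complex.continuous_im.comp h) continuous_const
  have hre : Continuous fun s : Regular => (cosMap s).re := Complex.continuous_re.comp h
  cases i
  · exact him.union (isOpen_lt hre.abs continuous_const)
  · exact him.union (isOpen_lt continuous_const hre)
  · exact him.union (isOpen_lt hre continuous_const)

/-- Different charts meet over the upper and the lower half-plane only. -/
lemma Chart.im_ne_zero {i j : Chart} (hij : i ≠ j) {s : Regular} (hi : s ∈ i.domain)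
    (hj : s ∈ j.domain) : (cosMap s).im ≠ 0 := by
  intro h0
  cases i <;> cases j <;> simp only [domain, Set.mem_ofPred_eq, h0, ne_eq, not_true_eq_false,
    false_or, abs_lt] at hi hj hij <;> grind

open Classical in
/-- A chart around a given point. -/
def chartAt (s : Regular) : Chart :=
  if s ∈ Chart.mid.domain then .mid else if s ∈ Chart.right.domain then .right else .left

lemma mem_domain_chartAt (s : Regular) : s ∈ (chartAt s).domain := by
  unfold chartAt
  split_ifs with h1 h2
  · exact h1
  · exact h2
  · simp only [Chart.domain, Set.mem_ofPred_eq, not_or, not_not, not_lt] at h1 h2 ⊢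
    right
    have h3 := abs_re_cosMap_ne_one s h1.1
    have h4 : 1 < |(cosMap s).re| := lt_of_le_of_ne h1.2 h3.symm
    rcases lt_abs.mp h4 with h5 | h5
    · linarith [h2.2]
    · linarith

lemma chartAt_of_mem_mid {s : Regular} (h : s ∈ Chart.mid.domain) : chartAt s = .mid := by
  simp [chartAt, h]

section Bundle

variable {G : Type*} [Group G]

/-- The transition from the chart `mid` over the upper (`true`) or lower (`false`) half-plane. -/
def sheet (A B : G) : Chart → Bool → G
  | .right, false => A
  | .left, true => B
  | _, _ => 1

/-- The transition from the chart `i` to the chart `j` over the points with imaginary part `x`. -/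
def jump (A B : G) (i j : Chart) (x : ℝ) : G :=
  if x = 0 then 1 else sheet A B j (decide (0 < x)) * (sheet A B i (decide (0 < x)))⁻¹

variable (A B : G)

@[simp] lemma jump_self (i : Chart) (x : ℝ) : jump A B i i x = 1 := by
  simp [jump]

lemma jump_mul_jump (i j k : Chart) (x : ℝ) :
    jump A B j k x * jump A B i j x = jump A B i k x := by
  unfold jump
  split_ifs <;> simp

lemma eventually_jump_eq (i j : Chart) {x : ℝ} (hx : x ≠ 0) :
    ∀ᶠ x' in nhds x, jump A B i j x' = jump A B i j x := by
  rcases lt_or_gt_of_ne hx with h | h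
  · filter_upwards [eventually_lt_nhds h] with x' hx'
    simp [jump, hx, hx'.ne, hx'.not_gt, h.not_gt]
  · filter_upwards [eventually_gt_nhds h] with x' hx'
    simp [jump, hx, hx'.ne', hx', h]

variable [TopologicalSpace G] [DiscreteTopology G]

/-- The principal bundle with discrete fibre `G` over the regular part in which a turn around the
axis over `1` multiplies by `A`, and a turn around the axis over `-1` multiplies by `B`. -/
def coneBundle : FiberBundleCore Chart Regular G where
  baseSet := Chart.domain
  isOpen_baseSet := Chart.isOpen_domain
  indexAt := chartAt
  mem_baseSet_at := mem_domain_chartAt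
  coordChange i j s v := jump A B i j (cosMap s).im * v
  coordChange_self i s _ v := by simp
  continuousOn_coordChange i j := by
    rintro ⟨s, v⟩ ⟨⟨hi, hj⟩, -⟩
    by_cases hij : i = j
    · subst hij
      simpa using continuous_snd.continuousWithinAt
    · have h0 := Chart.im_ne_zero hij hi hj
      have h1 : Continuous fun p : Regular × G => (cosMap p.1).im :=
        Complex.continuous_im.comp (continuous_cosMap.comp continuous_fst)
      have h2 := h1.continuousAt.eventually (eventually_jump_eq A B i j h0)
      refine ContinuousAt.continuousWithinAt ?_
      refine ContinuousAt.congr (f := fun p : Regular × G => jump A B i j (cosMap s).im * p.2) ?_ ?_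
      · exact (continuous_const.mul continuous_snd).continuousAt
      · filter_upwards [h2] with p hp
        rw [hp]
  coordChange_comp i j k s _ v := by rw [← mul_assoc, jump_mul_jump]

lemma isCoveringMap_coneBundle : IsCoveringMap (coneBundle A B).proj :=
  FiberBundle.isCoveringMap

end Bundle

/-! ### The charts around a curve in the cylinder -/

/-- The outer chart around the points over the integer `n` of the axis of the cylinder. -/
def outerChart (n : ℤ) : Chart := if Even n then .right else .left

/-- The generator of `G` attached to the cone axis through `(0, n)`. -/
def letter {G : Type*} (A B : G) (n : ℤ) : G := if Even n then A else B

section Charts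

variable {G : Type*} [Group G] {A B : G}
variable {z : ℂ} {u : ℝ} {hz : ‖z‖ ≤ 1} {h : ¬(z.im = 0 ∧ ∃ n : ℤ, u = n)} {n : ℤ}

lemma neg_one_zpow_mul_self (n : ℤ) : ((-1 : ℝ) ^ n) * (-1) ^ n = 1 := by
  rw [← mul_zpow]; simp

lemma sin_pi_mul_eq (u : ℝ) (n : ℤ) :
    Real.sin (Real.pi * u) = (-1) ^ n * Real.sin (Real.pi * (u - n)) := by
  rw [← Real.sin_add_int_mul_pi]; ring_nf

lemma sin_pi_mul_ne_zero (h1 : n < u) (h2 : u < n + 1) : Real.sin (Real.pi * u) ≠ 0 := by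
  have hpi := Real.pi_pos
  have : 0 < Real.sin (Real.pi * (u - n)) :=
    Real.sin_pos_of_pos_of_lt_pi (mul_pos hpi (by linarith)) (by nlinarith)
  rw [sin_pi_mul_eq u n]
  exact mul_ne_zero (zpow_ne_zero _ (by norm_num)) this.ne'

lemma chartAt_regularPoint_of_mem_Ioo (h1 : n < u) (h2 : u < n + 1) :
    chartAt (regularPoint z u hz h) = .mid := by
  refine chartAt_of_mem_mid ?_
  have hs := sin_pi_mul_ne_zero h1 h2
  by_cases h0 : z.im = 0
  · refine Or.inr ?_
    rw [cosMap_regularPoint_re, h0, mul_zero, Real.cosh_zero, mul_one]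
    have hsq := Real.sin_sq_add_cos_sq (Real.pi * u)
    rw [← sq_lt_one_iff_abs_lt_one]
    have := sq_pos_of_ne_zero hs
    linarith
  · refine Or.inl ?_
    rw [cosMap_regularPoint_im]
    have := Real.pi_pos.ne'
    simp [hs, h0, this]

lemma chartAt_regularPoint_int (hu : u = n) (h0 : z.im ≠ 0) :
    chartAt (regularPoint z u hz h) = outerChart n := by
  have him : (cosMap (regularPoint z u hz h)).im = 0 := by
    rw [cosMap_regularPoint_im, hu, mul_comm Real.pi, Real.sin_int_mul_pi]; simp
  have hre : (cosMap (regularPoint z u hz h)).re = (-1) ^ n * Real.cosh (Real.pi * z.im) := by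
    rw [cosMap_regularPoint_re, hu, mul_comm Real.pi, Real.cos_int_mul_pi]
  have hc : 1 < Real.cosh (Real.pi * z.im) :=
    Real.one_lt_cosh.mpr (mul_ne_zero Real.pi_pos.ne' h0)
  rcases Int.even_or_odd n with hn | hn
  · rw [hn.neg_one_zpow, one_mul] at hre
    have : |Real.cosh (Real.pi * z.im)| = Real.cosh (Real.pi * z.im) := abs_of_pos (Real.cosh_pos _)
    simp [chartAt, outerChart, hn, Chart.domain, him, hre, this, hc, hc.le]
  · rw [hn.neg_one_zpow, neg_one_mul] at hre
    have : |Real.cosh (Real.pi * z.im)| = Real.cosh (Real.pi * z.im) := abs_of_pos (Real.cosh_pos _)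
    have h3 : ¬ 1 < -Real.cosh (Real.pi * z.im) := by linarith
    simp [chartAt, outerChart, Int.not_even_iff_odd.mpr hn, Chart.domain, him, hre, this, hc.le, h3]

lemma jump_outerChart_of_pos {x : ℝ} (hx : 0 < (-1) ^ n * x) :
    jump A B .mid (outerChart n) x = 1 := by
  rcases Int.even_or_odd n with hn | hn
  · rw [hn.neg_one_zpow, one_mul] at hx
    simp [jump, outerChart, sheet, hn, hx, hx.ne']
  · rw [hn.neg_one_zpow, neg_one_mul] at hx
    have h1 : x < 0 := by linarith
    simp [jump, outerChart, sheet, Int.not_even_iff_odd.mpr hn, h1.ne, h1.not_gt]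

lemma jump_outerChart_of_neg {x : ℝ} (hx : (-1) ^ n * x < 0) :
    jump A B .mid (outerChart n) x = letter A B n := by
  rcases Int.even_or_odd n with hn | hn
  · rw [hn.neg_one_zpow, one_mul] at hx
    simp [jump, outerChart, sheet, letter, hn, hx.ne, hx.not_gt]
  · rw [hn.neg_one_zpow, neg_one_mul] at hx
    have h1 : 0 < x := by linarith
    simp [jump, outerChart, sheet, letter, Int.not_even_iff_odd.mpr hn, h1, h1.ne']

lemma neg_one_zpow_mul_im : (-1) ^ n * (cosMap (regularPoint z u hz h)).im =
    -(Real.sin (Real.pi * (u - n)) * Real.sinh (Real.pi * z.im)) := by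
  rw [cosMap_regularPoint_im, sin_pi_mul_eq u n]
  linear_combination (-(Real.sin (Real.pi * (u - n)) * Real.sinh (Real.pi * z.im))) *
    neg_one_zpow_mul_self n

lemma exists_mem_Ioo_of_ne (h1 : u ≠ n) (h2 : |u - n| < 1) : ∃ m : ℤ, m < u ∧ u < m + 1 := by
  rw [abs_lt] at h2
  rcases lt_or_gt_of_ne h1 with h3 | h3
  · exact ⟨n - 1, by push_cast; linarith, by push_cast; linarith⟩
  · exact ⟨n, h3, by linarith⟩

lemma sin_mul_sinh_pos {d y : ℝ} (hd : |d| < 1) (h : 0 < d * y) :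
    0 < Real.sin (Real.pi * d) * Real.sinh (Real.pi * y) := by
  have hpi := Real.pi_pos
  rw [abs_lt] at hd
  rcases pos_and_pos_or_neg_and_neg_of_mul_pos h with ⟨h1, h2⟩ | ⟨h1, h2⟩
  · exact mul_pos (Real.sin_pos_of_pos_of_lt_pi (mul_pos hpi h1) (by nlinarith))
      (Real.sinh_pos_iff.mpr (mul_pos hpi h2))
  · exact mul_pos_of_neg_of_neg
      (Real.sin_neg_of_neg_of_neg_pi_lt (mul_neg_of_pos_of_neg hpi h1) (by nlinarith))
      (Real.sinh_neg_iff.mpr (mul_neg_of_pos_of_neg hpi h2))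

/-- Near the integer `n`, the points before `n` above the axis and beyond `n` below it lie on the
trivial side of the cut. -/
lemma jump_regularPoint_eq_one (h2 : |u - n| < 1) (h3 : (u - n) * z.im < 0) :
    jump A B (chartAt (regularPoint z u hz h)) (outerChart n)
      (cosMap (regularPoint z u hz h)).im = 1 := by
  have hu : u ≠ n := fun e => by simp [e] at h3
  obtain ⟨m, h4, h5⟩ := exists_mem_Ioo_of_ne hu h2
  rw [chartAt_regularPoint_of_mem_Ioo h4 h5]
  apply jump_outerChart_of_pos
  rw [neg_one_zpow_mul_im]
  have := sin_mul_sinh_pos (d := u - n) (y := -z.im) h2 (by linarith)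
  rw [mul_neg, Real.sinh_neg] at this
  linarith

lemma jump_regularPoint_eq_letter (h2 : |u - n| < 1) (h3 : 0 < (u - n) * z.im) :
    jump A B (chartAt (regularPoint z u hz h)) (outerChart n)
      (cosMap (regularPoint z u hz h)).im = letter A B n := by
  have hu : u ≠ n := fun e => by simp [e] at h3
  obtain ⟨m, h4, h5⟩ := exists_mem_Ioo_of_ne hu h2
  rw [chartAt_regularPoint_of_mem_Ioo h4 h5]
  apply jump_outerChart_of_neg
  rw [neg_one_zpow_mul_im]
  have := sin_mul_sinh_pos (d := u - n) (y := z.im) h2 h3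
  linarith

end Charts

/-! ### Parallel transport -/

section Transport

variable {G : Type*} [Group G] [TopologicalSpace G] [DiscreteTopology G] (A B : G)

/-- Right translation in the fibres of the principal bundle. -/
def rightTranslate (g : G) (e : (coneBundle A B).TotalSpace) : (coneBundle A B).TotalSpace :=
  ⟨e.1, (show G from e.2) * g⟩

/-- A map to the total space is continuous if its fibre coordinate is locally constant in the
charts. -/
lemma continuous_coneBundle_mk {P : Type*} [TopologicalSpace P] {c : P → Regular}
    (hc : Continuous c) (g : P → G)
    (hg : ∀ p, ∀ᶠ p' in nhds p,
      jump A B (chartAt (c p')) (chartAt (c p)) (cosMap (c p')).im * g p' = g p) :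
    Continuous fun p => (⟨c p, g p⟩ : (coneBundle A B).TotalSpace) := by
  rw [continuous_iff_continuousAt]
  intro p
  rw [FiberBundle.continuousAt_totalSpace]
  refine ⟨hc.continuousAt, ?_⟩
  refine (continuousAt_const (y := g p)).congr ?_
  filter_upwards [hg p] with p' hp'
  exact hp'.symm

lemma continuous_rightTranslate (g : G) : Continuous (rightTranslate A B g) := by
  rw [continuous_iff_continuousAt]
  intro e
  have h := (FiberBundle.continuousAt_totalSpace G (fun e : (coneBundle A B).TotalSpace => e)
    (x₀ := e)).mp continuousAt_id
  rw [FiberBundle.continuousAt_totalSpace]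
  refine ⟨h.1, ?_⟩
  refine ContinuousAt.congr (h.2.mul (continuousAt_const (y := g))) ?_
  filter_upwards with e'
  exact mul_assoc _ _ _

/-- The element of `G` by which parallel transport along a path acts on the fibres of the principal
bundle. -/
def transport {x y : Regular} (γ : Path.Homotopic.Quotient x y) : G :=
  ((isCoveringMap_coneBundle A B).monodromy γ ⟨⟨x, (1 : G)⟩, rfl⟩).1.2

variable {A B}

lemma monodromy_mk {x y : Regular} (c : Path x y) (g : unitInterval → G)
    (hg : Continuous fun t => (⟨c t, g t⟩ : (coneBundle A B).TotalSpace)) :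
    (isCoveringMap_coneBundle A B).monodromy (.mk c) ⟨⟨x, g 0⟩, rfl⟩ = ⟨⟨y, g 1⟩, rfl⟩ := by
  let Γ : Path (⟨x, g 0⟩ : (coneBundle A B).TotalSpace) ⟨y, g 1⟩ :=
    { toFun := fun t => ⟨c t, g t⟩
      continuous_toFun := hg
      source' := congrArg (fun s => (⟨s, g 0⟩ : (coneBundle A B).TotalSpace)) c.source
      target' := congrArg (fun s => (⟨s, g 1⟩ : (coneBundle A B).TotalSpace)) c.target }
  exact (isCoveringMap_coneBundle A B).monodromy_map (.mk Γ)

lemma exists_lift {x y : Regular} (c : Path x y) (v : G) : ∃ g : unitInterval → G, g 0 = v ∧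
    Continuous fun t => (⟨c t, g t⟩ : (coneBundle A B).TotalSpace) := by
  let cov := isCoveringMap_coneBundle A B
  have h0 : (c : C(unitInterval, Regular)) 0 = (coneBundle A B).proj ⟨x, v⟩ := by simp
  have h1 : ∀ t, (cov.liftPath c ⟨x, v⟩ h0 t).1 = c t := fun t =>
    congrFun (cov.liftPath_lifts c ⟨x, v⟩ h0) t
  refine ⟨fun t => (cov.liftPath c ⟨x, v⟩ h0 t).2, ?_, ?_⟩
  · change (show G from (cov.liftPath c ⟨x, v⟩ h0 0).2) = v
    rw [cov.liftPath_zero c ⟨x, v⟩ h0]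
  · convert! (cov.liftPath c ⟨x, v⟩ h0).continuous using 2 with t
    rw [← h1 t]

lemma monodromy_eq {x y : Regular} (γ : Path.Homotopic.Quotient x y) (v : G) :
    (isCoveringMap_coneBundle A B).monodromy γ ⟨⟨x, v⟩, rfl⟩ = ⟨⟨y, transport A B γ * v⟩, rfl⟩ := by
  induction γ using Path.Homotopic.Quotient.ind with | mk c =>
  obtain ⟨g, h0, hg⟩ := exists_lift (A := A) (B := B) c 1
  have h1 := monodromy_mk c g hg
  have h2 := monodromy_mk c (fun t => g t * v) ((continuous_rightTranslate A B v).comp hg)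
  rw [h0] at h1
  rw [h0, one_mul] at h2
  rw [h2, transport, h1]

lemma transport_mul_of_lift {x y : Regular} {c : Path x y} {g : unitInterval → G}
    (hg : Continuous fun t => (⟨c t, g t⟩ : (coneBundle A B).TotalSpace)) :
    transport A B (.mk c) * g 0 = g 1 := by
  have h := monodromy_mk c g hg
  rw [monodromy_eq] at h
  simpa using congrArg (fun e => (show G from e.1.2)) h

lemma transport_refl (x : Regular) : transport A B (.refl x) = 1 := by
  rw [transport, (isCoveringMap_coneBundle A B).monodromy_refl]; rfl

lemma transport_trans {x y z : Regular} (γ : Path.Homotopic.Quotient x y)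
    (δ : Path.Homotopic.Quotient y z) :
    transport A B (γ.trans δ) = transport A B δ * transport A B γ := by
  have h := (isCoveringMap_coneBundle A B).monodromy_trans_apply γ δ ⟨⟨x, (1 : G)⟩, rfl⟩
  simp only [monodromy_eq, mul_one] at h
  simpa using congrArg (fun e => (show G from e.1.2)) h

lemma transport_symm {x y : Regular} (γ : Path.Homotopic.Quotient x y) :
    transport A B γ.symm = (transport A B γ)⁻¹ := by
  rw [eq_inv_iff_mul_eq_one, ← transport_trans, Path.Homotopic.Quotient.trans_symm, transport_refl]

/-- Parallel transport as a homomorphism on the fundamental group. -/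
def transportHom (A B : G) (x : Regular) : FundamentalGroup Regular x →* G where
  toFun γ := transport A B γ
  map_one' := transport_refl x
  map_mul' γ δ := transport_trans δ γ

lemma FreelyHomotopic.isConj_transport {x y : Regular} {α : Path x x} {β : Path y y}
    (h : FreelyHomotopic α β) : IsConj (transport A B (.mk α)) (transport A B (.mk β)) := by
  obtain ⟨c, hc⟩ := freelyHomotopic_iff.mp h
  have := congrArg (transport A B) hc
  rw [transport_trans, transport_trans] at this
  exact isConj_iff.mpr ⟨transport A B c, by rw [this, mul_inv_cancel_right]⟩

end Transport

/-! ### Transport around graphs and meridians -/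

section GraphTransport

variable {G : Type*}

/-- The lift over the graph of a profile: it is `g n` over the interval `(n, n + 1)`. -/
def graphLift {q : ℕ} (y : Profile q) (g : ℤ → G) (u : ℝ) : G :=
  if 0 < y u then g (⌈u⌉ - 1) else g ⌊u⌋

lemma graphLift_of_mem_Ioo {q : ℕ} (y : Profile q) (g : ℤ → G) {u : ℝ} {n : ℤ} (h1 : n < u)
    (h2 : u < n + 1) : graphLift y g u = g n := by
  have hf : ⌊u⌋ = n := Int.floor_eq_iff.mpr ⟨h1.le, h2⟩
  have hc : ⌈u⌉ = n + 1 := Int.ceil_eq_iff.mpr ⟨by push_cast; linarith, by push_cast; linarith⟩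
  simp [graphLift, hf, hc]

variable [Group G] {A B : G}

/-- Over each integer `n`, the lift jumps by the letter of the axis, in the direction determined by
the side on which the axis is passed. -/
lemma eventually_jump_graphLift {q : ℕ} (y : Profile q) (g : ℤ → G)
    (hg : ∀ n : ℤ, if 0 < y n then g (n - 1) = letter A B n * g n
      else g n = letter A B n * g (n - 1)) (v : ℝ) :
    ∀ᶠ u in nhds v, jump A B (chartAt (graphPoint y u)) (chartAt (graphPoint y v))
      (cosMap (graphPoint y u)).im * graphLift y g u = graphLift y g v := by
  by_cases hv : ∃ n : ℤ, v = n
  · obtain ⟨n, rfl⟩ := hv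
    have h0 : y n ≠ 0 := y.ne_zero' n
    have hidx : chartAt (graphPoint y (n : ℝ)) = outerChart n :=
      chartAt_regularPoint_int rfl (by simpa using h0)
    have hnear : ∀ᶠ u : ℝ in nhds (n : ℝ), |u - n| < 1 := by
      filter_upwards [Metric.ball_mem_nhds (n : ℝ) zero_lt_one] with u hu
      simpa [Real.dist_eq] using hu
    have him : ∀ u : ℝ, ((y u : ℂ) * Complex.I).im = y u := fun u => by simp
    have hn := hg n
    rcases lt_or_gt_of_ne h0 with hy | hy
    · rw [if_neg hy.not_gt] at hn
      have hval : graphLift y g (n : ℝ) = g n := by simp [graphLift, hy.not_gt]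
      filter_upwards [hnear, y.continuous'.continuousAt.eventually (eventually_lt_nhds hy)]
        with u hu hyu
      have hu' := abs_lt.mp hu
      rcases lt_trichotomy u n with h | h | h
      · rw [hidx, hval, graphPoint, jump_regularPoint_eq_letter hu
          (by rw [him]; exact mul_pos_of_neg_of_neg (by linarith) hyu),
          graphLift_of_mem_Ioo y g (n := n - 1) (by push_cast; linarith) (by push_cast; linarith),
          hn]
      · rw [h, jump_self, one_mul]
      · rw [hidx, hval, graphPoint, jump_regularPoint_eq_one hu
          (by rw [him]; exact mul_neg_of_pos_of_neg (by linarith) hyu),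
          graphLift_of_mem_Ioo y g h (by linarith), one_mul]
    · rw [if_pos hy] at hn
      have hval : graphLift y g (n : ℝ) = g (n - 1) := by simp [graphLift, hy]
      filter_upwards [hnear, y.continuous'.continuousAt.eventually (eventually_gt_nhds hy)]
        with u hu hyu
      have hu' := abs_lt.mp hu
      rcases lt_trichotomy u n with h | h | h
      · rw [hidx, hval, graphPoint, jump_regularPoint_eq_one hu
          (by rw [him]; exact mul_neg_of_neg_of_pos (by linarith) hyu),
          graphLift_of_mem_Ioo y g (n := n - 1) (by push_cast; linarith) (by push_cast; linarith),
          one_mul]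
      · rw [h, jump_self, one_mul]
      · rw [hidx, hval, graphPoint, jump_regularPoint_eq_letter hu
          (by rw [him]; exact mul_pos (by linarith) hyu),
          graphLift_of_mem_Ioo y g h (by linarith), hn]
  · have h1 : (⌊v⌋ : ℝ) < v := lt_of_le_of_ne (Int.floor_le v) fun e => hv ⟨_, e.symm⟩
    have h2 := Int.lt_floor_add_one v
    filter_upwards [Ioo_mem_nhds h1 h2] with u hu
    rw [graphLift_of_mem_Ioo y g h1 h2, graphLift_of_mem_Ioo y g hu.1 hu.2, graphPoint, graphPoint,
      chartAt_regularPoint_of_mem_Ioo h1 h2, chartAt_regularPoint_of_mem_Ioo hu.1 hu.2, jump_self,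
      one_mul]

variable [TopologicalSpace G] [DiscreteTopology G]

/-- Transport around the graph of a profile is the product of the letters of the axes that are
passed, each with the sign of the side on which it is passed. -/
lemma transport_graphLoop {q : ℕ} (y : Profile q) (g : ℤ → G)
    (hg : ∀ n : ℤ, if 0 < y n then g (n - 1) = letter A B n * g n
      else g n = letter A B n * g (n - 1)) :
    transport A B (.mk (graphLoop y (1 / 2))) * g 0 = g (2 * q) := by
  have hlift := continuous_coneBundle_mk A B (graphLoop y (1 / 2)).continuous
    (fun t => graphLift y g (1 / 2 + 2 * q * t)) fun t => by
      have hc : Continuous fun t : unitInterval => (1 / 2 + 2 * q * t : ℝ) := by fun_prop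
      exact hc.continuousAt.eventually (eventually_jump_graphLift y g hg _)
  have h := transport_mul_of_lift hlift
  simp only [Set.Icc.coe_zero, Set.Icc.coe_one, mul_zero, mul_one, add_zero] at h
  rwa [graphLift_of_mem_Ioo y g (n := 0) (by norm_num) (by norm_num),
    graphLift_of_mem_Ioo y g (n := 2 * q) (by push_cast; linarith) (by push_cast; linarith)] at h

lemma meridian_apply_eq (j : ℤ) (t : unitInterval) : ∃ hz h, meridian j t =
    regularPoint (((Real.cos (Real.pi * t) / 2 : ℝ) : ℂ) * Complex.I)
      (j + Real.sin (Real.pi * t) / 2) hz h :=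
  ⟨(meridianLift j t).2, notMem_axes_of_proj (meridianLift_regular j t), rfl⟩

/-- The lift of a meridian changes only when it leaves its base point, above the axis; it returns
below the axis, on the trivial side of the cut. -/
lemma transport_meridian (j : ℤ) :
    transport A B (.mk (meridian j)) = (letter A B j)⁻¹ := by
  have hpi := Real.pi_pos
  have him : ∀ x : ℝ, ((x : ℂ) * Complex.I).im = x := fun x => by simp
  have hsin : ∀ t : unitInterval, 0 < t → t < 1 → 0 < Real.sin (Real.pi * t) := fun t h0 h1 => by
    have h0' : (0 : ℝ) < t := h0
    have h1' : (t : ℝ) < 1 := h1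
    exact Real.sin_pos_of_pos_of_lt_pi (by positivity) (by nlinarith)
  have hsin_le : ∀ t : unitInterval, Real.sin (Real.pi * t) ≤ 1 := fun t => Real.sin_le_one _
  have hmid : ∀ t : unitInterval, 0 < t → t < 1 → chartAt (meridian j t) = .mid := by
    intro t h0 h1
    obtain ⟨_, _, e⟩ := meridian_apply_eq j t
    rw [e]
    exact chartAt_regularPoint_of_mem_Ioo (n := j) (by linarith [hsin t h0 h1])
      (by linarith [hsin_le t])
  have hlift := continuous_coneBundle_mk A B (meridian j).continuous
    (fun t => if t = 0 then letter A B j else 1) fun t => by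
      rcases eq_or_ne t 0 with rfl | h0
      · have hidx : chartAt (meridian j 0) = outerChart j := by
          obtain ⟨_, _, e⟩ := meridian_apply_eq j 0
          rw [e]
          exact chartAt_regularPoint_int (by simp) (by rw [him]; simp)
        filter_upwards [eventually_lt_nhds (show (0 : unitInterval) <
          ⟨1 / 2, by norm_num, by norm_num⟩ from Subtype.mk_lt_mk.mpr (by norm_num))] with t ht
        rcases eq_or_ne t 0 with rfl | h0
        · rw [jump_self, one_mul]
        · have h0 : 0 < t := unitInterval.pos_iff_ne_zero.mpr h0
          have ht' : (t : ℝ) < 1 / 2 := ht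
          have h0' : (0 : ℝ) < t := h0
          have hs := hsin t h0 (by rw [← unitInterval.coe_lt_one]; linarith)
          have hc : 0 < Real.cos (Real.pi * t) :=
            Real.cos_pos_of_mem_Ioo ⟨by nlinarith, by nlinarith⟩
          obtain ⟨_, _, e⟩ := meridian_apply_eq j t
          rw [hidx, e, jump_regularPoint_eq_letter]
          · simp [h0.ne']
          · rw [add_sub_cancel_left, abs_of_pos (by linarith)]; linarith [hsin_le t]
          · rw [him, add_sub_cancel_left]; positivity
      · have h0 : 0 < t := unitInterval.pos_iff_ne_zero.mpr h0
        rcases eq_or_ne t 1 with rfl | h1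
        · have hidx : chartAt (meridian j 1) = outerChart j := by
            obtain ⟨_, _, e⟩ := meridian_apply_eq j 1
            rw [e]
            exact chartAt_regularPoint_int (by simp) (by rw [him]; simp)
          filter_upwards [eventually_gt_nhds (show ⟨1 / 2, by norm_num, by norm_num⟩ <
            (1 : unitInterval) from Subtype.mk_lt_mk.mpr (by norm_num))] with t ht
          have ht' : 1 / 2 < (t : ℝ) := ht
          have ht0 : 0 < t := by rw [← unitInterval.coe_pos]; linarith
          rcases eq_or_ne t 1 with rfl | h1
          · rw [jump_self, one_mul]
          · have h1 : t < 1 := unitInterval.lt_one_iff_ne_one.mpr h1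
            have h1' : (t : ℝ) < 1 := h1
            have hs := hsin t ht0 h1
            have hc : Real.cos (Real.pi * t) < 0 :=
              Real.cos_neg_of_pi_div_two_lt_of_lt (by nlinarith) (by nlinarith)
            obtain ⟨_, _, e⟩ := meridian_apply_eq j t
            rw [hidx, e, jump_regularPoint_eq_one]
            · simp [ht0.ne']
            · rw [add_sub_cancel_left, abs_of_pos (by linarith)]; linarith [hsin_le t]
            · rw [him, add_sub_cancel_left]
              exact mul_neg_of_pos_of_neg (by linarith) (by linarith)
        · have h1 : t < 1 := unitInterval.lt_one_iff_ne_one.mpr h1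
          filter_upwards [Ioo_mem_nhds h0 h1] with t' ht'
          rw [hmid t h0 h1, hmid t' ht'.1 ht'.2, jump_self, one_mul, if_neg h0.ne',
            if_neg ht'.1.ne']
  have h := transport_mul_of_lift hlift
  rw [eq_inv_iff_mul_eq_one]
  simpa using h

/-- Transport factors through the orbifold fundamental group when `A` and `B` have order three. -/
lemma OrbifoldHomotopic.isConj_transport (hA : A ^ 3 = 1) (hB : B ^ 3 = 1) {x y : Regular}
    {α : Path x x} {β : Path y y} (h : OrbifoldHomotopic α β) :
    IsConj (transport A B (.mk α)) (transport A B (.mk β)) := by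
  obtain ⟨c, hc⟩ := h
  have hker : Subgroup.normalClosure (coneRelators x) ≤ (transportHom A B x).ker := by
    refine Subgroup.normalClosure_le_normal ?_
    rintro _ ⟨j, -, d, rfl⟩
    rw [SetLike.mem_coe, MonoidHom.mem_ker, map_pow]
    change transport A B (.mk _) ^ 3 = 1
    have h3 : letter A B j ^ 3 = 1 := by
      unfold letter; split_ifs <;> assumption
    rw [Path.Homotopic.Quotient.mk_trans, Path.Homotopic.Quotient.mk_trans,
      Path.Homotopic.Quotient.mk_symm, transport_trans, transport_trans, transport_symm,
      transport_meridian]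
    have := conj_pow (i := 3) (a := (transport A B (.mk d))⁻¹) (b := (letter A B j)⁻¹)
    rw [inv_inv] at this
    rw [← mul_assoc, this, inv_pow, h3]
    simp
  have h1 := hker (QuotientGroup.eq.mp hc)
  rw [MonoidHom.mem_ker, map_mul, map_inv, inv_mul_eq_one] at h1
  change transport A B (.mk α) = transport A B (.mk _) at h1
  rw [Path.Homotopic.Quotient.mk_trans, Path.Homotopic.Quotient.mk_trans,
      Path.Homotopic.Quotient.mk_symm, transport_trans, transport_trans, transport_symm] at h1
  rw [h1]
  exact isConj_iff.mpr ⟨transport A B (.mk c), by group⟩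

end GraphTransport

/-! ### A free product of two cyclic groups of order three acting on words -/

/-- The vertices of the Bass-Serre tree of `ℤ/3 * ℤ/3`, as reduced words in two letters of order
three. The letters alternate, so that the first letter and the list of the exponents `±1` (`true`
for `1`) determine the word, together with the letter that would come next after its end. Two words
that differ by a power of this next letter on the right are the same vertex. In particular `(c, [])`
is the vertex fixed by the letter `c`. -/
abbrev State : Type := Bool × List Bool

namespace State

/-- Multiplication from the left by the letter `c` (for `e = true`) or its inverse (for
`e = false`). The letter fixes `(c, [])`; the other vertices fall into orbits of length three. -/
def step (c e : Bool) : State → State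
  | (d, w) => if d = c then
      match w with
      | [] => (c, [])
      | a :: t => if a = e then (c, (!e) :: t) else (!c, t)
    else (c, e :: w)

lemma step_step (c e : Bool) (v : State) : step c (!e) (step c e v) = v := by
  obtain ⟨d, _ | ⟨a, t⟩⟩ := v <;> cases c <;> cases d <;> cases e <;> try cases a
  all_goals simp [step]

/-- The letter `c` as a permutation of the states. -/
def gen (c : Bool) : Equiv.Perm State where
  toFun := step c true
  invFun := step c false
  left_inv := step_step c true
  right_inv := step_step c false

lemma gen_apply (c : Bool) (v : State) : gen c v = step c true v := rfl

lemma gen_pow_three (c : Bool) : gen c ^ 3 = 1 := by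
  ext1 v
  simp only [pow_succ, pow_zero, one_mul, Equiv.Perm.mul_apply, gen_apply, Equiv.Perm.one_apply]
  obtain ⟨d, _ | ⟨a, t⟩⟩ := v <;> cases c <;> cases d <;> try cases a
  all_goals simp [step]

/-- The number of sign changes in a list of exponents. -/
def signChanges : List Bool → ℤ
  | [] => 0
  | [_] => 0
  | a :: b :: t => (if a = b then 0 else 1) + signChanges (b :: t)

lemma signChanges_cons (a : Bool) (t : List Bool) :
    signChanges t ≤ signChanges (a :: t) ∧ signChanges (a :: t) ≤ signChanges t + 1 := by
  cases t with
  | nil => simp [signChanges]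
  | cons b t => simp only [signChanges]; split_ifs <;> constructor <;> linarith

/-- The length of a word. -/
def length (v : State) : ℤ := v.2.length

/-- The number of sign changes of a word. -/
def turns (v : State) : ℤ := signChanges v.2

lemma abs_step_le (c e : Bool) (v : State) :
    |length (step c e v) - length v| ≤ 1 ∧ |turns (step c e v) - turns v| ≤ 1 := by
  obtain ⟨d, _ | ⟨a, t⟩⟩ := v
  · simp only [step, length, turns]
    split_ifs <;> simp [signChanges]
  · have h1 := signChanges_cons a t
    have h2 := signChanges_cons (!e) t
    have h3 := signChanges_cons e (a :: t)
    simp only [step, length, turns, abs_le]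
    split_ifs <;> simp <;> grind

/-- The permutations of the words that change the length and the number of sign changes by a bounded
amount. -/
def boundedPerm : Subgroup (Equiv.Perm State) where
  carrier := {g | ∃ K : ℤ, ∀ v, |length (g v) - length v| ≤ K ∧ |turns (g v) - turns v| ≤ K}
  one_mem' := ⟨0, fun v => by simp⟩
  mul_mem' := by
    rintro g h ⟨K, hK⟩ ⟨L, hL⟩
    refine ⟨K + L, fun v => ?_⟩
    have h1 := hK (h v)
    have h2 := hL v
    rw [Equiv.Perm.mul_apply]
    simp only [abs_le] at h1 h2 ⊢
    omega
  inv_mem' := by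
    rintro g ⟨K, hK⟩
    refine ⟨K, fun v => ?_⟩
    have h1 := hK (g⁻¹ v)
    rw [show g (g⁻¹ v) = v from g.apply_symm_apply v] at h1
    simp only [abs_le] at h1 ⊢
    omega

/-- The letter `c` as an element of the group of bounded permutations. -/
def genBounded (c : Bool) : boundedPerm := ⟨gen c, 1, abs_step_le c true⟩

lemma genBounded_pow_three (c : Bool) : genBounded c ^ 3 = 1 :=
  Subtype.ext (gen_pow_three c)

section Sequence

variable {c e : ℕ → Bool} {v : ℕ → State}

/-- An alternating sequence of letters eventually stops to cancel against a given word. -/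
lemma exists_forall_step_eq_cons (hc : ∀ n, c (n + 1) = !c n)
    (hv : ∀ n, v (n + 1) = step (c (n + 1)) (e (n + 1)) (v n)) : ∃ n₀, ∀ n ≥ n₀,
    v (n + 1) = (c (n + 1), e (n + 1) :: (v n).2) := by
  have hstep : ∀ n, (v n).1 = c n → v (n + 1) = (c (n + 1), e (n + 1) :: (v n).2) := by
    intro n hn
    have hne : ¬ (v n).1 = c (n + 1) := by rw [hn, hc]; simp
    rw [hv]
    generalize v n = x at hne
    obtain ⟨d, w⟩ := x
    simp only [step]
    rw [if_neg hne]
  by_cases h : ∃ n₀, (v n₀).1 = c n₀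
  · obtain ⟨n₀, h₀⟩ := h
    have hall : ∀ n ≥ n₀, (v n).1 = c n := by
      intro n hn
      induction n, hn using Nat.le_induction with
      | base => exact h₀
      | succ n _ ih => rw [hstep n ih]
    exact ⟨n₀, fun n hn => hstep n (hall n hn)⟩
  · exfalso
    push Not at h
    -- Otherwise every letter cancels, so that the length decreases forever.
    have hdec : ∀ n, (v (n + 1)).2.length + 1 = (v n).2.length := by
      intro n
      have h1 := h (n + 1)
      have h2 : (v n).1 = c (n + 1) := by
        rw [hc]; have := h n; revert this; cases (v n).1 <;> cases c n <;> simp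
      rw [hv] at h1 ⊢
      generalize v n = x at h1 h2
      obtain ⟨d, _ | ⟨a, t⟩⟩ := x <;> obtain rfl : d = c (n + 1) := h2
      · simp [step] at h1
      · simp only [step, if_true] at h1 ⊢
        by_cases ha : a = e (n + 1)
        · simp [ha] at h1
        · simp [ha]
    have hsum : ∀ n, (v n).2.length + n = (v 0).2.length := by
      intro n
      induction n with
      | zero => simp
      | succ n ih => rw [← ih, ← hdec n]; omega
    have := hsum ((v 0).2.length + 1)
    omega

/-- When the exponents are the parities of a sequence with increments `0` and `1`, the number of
sign changes follows that sequence, while the length follows the index. -/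
lemma exists_forall_length_turns_eq (hc : ∀ n, c (n + 1) = !c n)
    (hv : ∀ n, v (n + 1) = step (c (n + 1)) (e (n + 1)) (v n)) {m : ℕ → ℤ}
    (hm : ∀ n, m (n + 1) = m n ∨ m (n + 1) = m n + 1)
    (he : ∀ n, e n = true ↔ Odd (m n)) :
    ∃ (C D : ℤ) (n₀ : ℕ), ∀ n ≥ n₀, length (v n) = n + C ∧ turns (v n) = m n + D := by
  obtain ⟨n₀, h⟩ := exists_forall_step_eq_cons hc hv
  refine ⟨length (v (n₀ + 1)) - (n₀ + 1 : ℕ), turns (v (n₀ + 1)) - m (n₀ + 1), n₀ + 1, ?_⟩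
  intro n hn
  induction n, hn using Nat.le_induction with
  | base => constructor <;> ring
  | succ n hn ih =>
    obtain ⟨k, rfl⟩ : ∃ k, n = k + 1 := ⟨n - 1, by omega⟩
    have h1 := h k (by omega)
    have h2 := h (k + 1) (by omega)
    obtain ⟨ih1, ih2⟩ := ih
    constructor
    · have h3 : length (v (k + 1 + 1)) = length (v (k + 1)) + 1 := by
        rw [h2]; simp [length]
      rw [h3, ih1]
      push_cast
      ring
    · have h3 : turns (v (k + 1 + 1)) =
          (if e (k + 1 + 1) = e (k + 1) then 0 else 1) + turns (v (k + 1)) := by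
        rw [h2, h1]; rfl
      rw [h3, ih2]
      have e1 := he (k + 1)
      have e2 := he (k + 1 + 1)
      rcases hm (k + 1) with h4 | h4
      · rw [h4] at e2
        rw [if_pos (Bool.eq_iff_iff.mpr (e2.trans e1.symm)), h4]; ring
      · rw [h4, ← Int.not_even_iff_odd, Int.even_add_one, Int.not_even_iff_odd] at e2
        rw [if_neg (fun h5 => by rw [h5] at e2; tauto), h4]; ring

end Sequence

end State

/-- An element of `boundedPerm` has translation lengths `(l, t)` if its powers move every word at
these rates, for the length and the number of sign changes. -/
def HasRates (T : State.boundedPerm) (l t : ℤ) : Prop :=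
  ∀ v : State, ∃ (C : ℤ) (k₀ : ℕ), ∀ k ≥ k₀, |State.length ((T ^ k).1 v) - l * k| ≤ C ∧
    |State.turns ((T ^ k).1 v) - t * k| ≤ C

lemma eq_zero_of_forall_abs_mul_le {a C : ℤ} {k₀ : ℕ} (h : ∀ k : ℕ, k ≥ k₀ → |a * k| ≤ C) :
    a = 0 := by
  by_contra ha
  have h1 := h (k₀ + C.natAbs + 1) (by omega)
  rw [abs_mul] at h1
  have h2 : 1 ≤ |a| := Int.one_le_abs ha
  have h3 : (0 : ℤ) ≤ |((k₀ + C.natAbs + 1 : ℕ) : ℤ)| := abs_nonneg _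
  have h4 : |((k₀ + C.natAbs + 1 : ℕ) : ℤ)| ≤ C := by nlinarith
  rw [Nat.abs_cast] at h4
  omega

/-- Rates are conjugacy invariants, because conjugating elements displace words by a bounded
amount. -/
lemma HasRates.eq_of_isConj {T T' : State.boundedPerm} {l t l' t' : ℤ} (h : HasRates T l t)
    (h' : HasRates T' l' t') (hc : IsConj T T') : l = l' ∧ t = t' := by
  obtain ⟨c, hc⟩ := isConj_iff.mp hc
  obtain ⟨K, hK⟩ := c.2
  obtain ⟨C, k₀, h1⟩ := h (false, [])
  obtain ⟨C', k₀', h2⟩ := h' (c.1 (false, []))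
  have hpow : ∀ k : ℕ, (T' ^ k).1 (c.1 (false, [])) = c.1 ((T ^ k).1 (false, [])) := by
    intro k
    rw [← hc, conj_pow]
    simp
  have key : ∀ k : ℕ, k ≥ max k₀ k₀' →
      |(l - l') * k| ≤ C + C' + K ∧ |(t - t') * k| ≤ C + C' + K := by
    intro k hk
    have a1 := h1 k (le_of_max_le_left hk)
    have a2 := h2 k (le_of_max_le_right hk)
    have a3 := hK ((T ^ k).1 (false, []))
    rw [hpow] at a2
    simp only [abs_le, sub_mul] at *
    omega
  constructor
  · linarith [eq_zero_of_forall_abs_mul_le fun k hk => (key k hk).1]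
  · linarith [eq_zero_of_forall_abs_mul_le fun k hk => (key k hk).2]

/-! ### The rates of the curves of rational slope -/

/-- As the structure group of a covering, the group of bounded permutations is discrete. -/
instance : TopologicalSpace State.boundedPerm := ⊥

instance : DiscreteTopology State.boundedPerm := ⟨rfl⟩

lemma exists_int_recursion {G : Type*} [Group G] (s : ℤ → G) :
    ∃ g : ℤ → G, g 0 = 1 ∧ ∀ n, g n = s n * g (n - 1) := by
  -- The values at the natural numbers, and at their negatives.
  let P : ℕ → G := fun k => Nat.rec 1 (fun i x => s (i + 1) * x) k
  let N : ℕ → G := fun k => Nat.rec 1 (fun i x => (s (-i))⁻¹ * x) k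
  refine ⟨fun n => if 0 ≤ n then P n.toNat else N (-n).toNat, rfl, fun n => ?_⟩
  beta_reduce
  rcases lt_trichotomy n 0 with h | rfl | h
  · obtain ⟨k, rfl⟩ : ∃ k : ℕ, n = -k := ⟨(-n).toNat, by omega⟩
    have h1 : (-(-(k : ℤ) - 1)).toNat = k + 1 := by omega
    have h2 : (- -(k : ℤ)).toNat = k := by omega
    rw [if_neg (by omega), if_neg (by omega), h1, h2]
    exact (mul_inv_cancel_left _ _).symm
  · have h1 : (-((0 : ℤ) - 1)).toNat = 1 := by omega
    rw [if_pos le_rfl, if_neg (by omega), h1]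
    simp [P, N]
  · obtain ⟨k, rfl⟩ : ∃ k : ℕ, n = k + 1 := ⟨(n - 1).toNat, by omega⟩
    have h1 : ((k : ℤ) + 1).toNat = k + 1 := by omega
    have h2 : ((k : ℤ) + 1 - 1).toNat = k := by omega
    rw [if_pos (by omega), if_pos (by omega), h1, h2]

/-- Powers of the transport around a graph follow the lift over the whole line. -/
lemma transport_graphLoop_pow {G : Type*} [Group G] [TopologicalSpace G] [DiscreteTopology G]
    {A B : G} {q : ℕ} (y : Profile q) (g : ℤ → G)
    (hg : ∀ n : ℤ, if 0 < y n then g (n - 1) = letter A B n * g n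
      else g n = letter A B n * g (n - 1)) (k : ℕ) :
    transport A B (.mk (graphLoop y (1 / 2))) ^ k * g 0 = g (2 * q * k) := by
  induction k with
  | zero => simp
  | succ k ih =>
    have hper : ∀ n : ℤ, y ((n + 2 * q * k : ℤ) : ℝ) = y n := by
      intro n
      have : ∀ i : ℕ, y (n + 2 * q * i) = y n := by
        intro i
        induction i with
        | zero => simp
        | succ i ih => rw [← ih, ← y.periodic' (n + 2 * q * i)]; push_cast; ring_nf
      rw [← this k]; push_cast; rfl
    have hlet : ∀ n : ℤ, letter A B (n + 2 * q * k) = letter A B n := by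
      intro n
      have : Even (n + 2 * q * k) ↔ Even n := by
        rw [Int.even_add, mul_assoc]; simp
      simp [letter, this]
    have h := transport_graphLoop y (fun n => g (n + 2 * q * k)) fun n => by
      have h1 := hg (n + 2 * q * k)
      rw [hper, hlet] at h1
      rwa [show n - 1 + 2 * q * k = n + 2 * q * k - 1 by ring]
    rw [pow_succ', mul_assoc, ih]
    rw [zero_add] at h
    rw [h]
    push_cast; ring_nf

open State in
/-- Along a line of slope `t ∈ [0, 1]`, each period of the line contributes `2q` letters, and a sign
change for each of the `2p` integers that are passed. -/
lemma hasRates_transport {q : ℕ} {t : ℚ} (h0 : 0 ≤ t) (h1 : t ≤ 1) {p : ℤ} (hp : q * t = p)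
    {β : ℝ} {hq hβ} :
    HasRates (transport (genBounded true) (genBounded false)
      (.mk (graphLoop (sinProfile q t β hq hβ) (1 / 2)))) (2 * q) (2 * p) := by
  intro v₀
  set y := sinProfile q t β hq hβ with hy
  set L : ℤ → boundedPerm := letter (genBounded true) (genBounded false) with hL
  obtain ⟨g, hg0, hg⟩ := exists_int_recursion fun n => if 0 < y n then (L n)⁻¹ else L n
  have hg' : ∀ n : ℤ, if 0 < y n then g (n - 1) = L n * g n else g n = L n * g (n - 1) := by
    intro n
    have := hg n
    split_ifs at this ⊢
    · rw [this, mul_inv_cancel_left]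
    · exact this
  have hpow := transport_graphLoop_pow y g hg'
  rw [hg0] at hpow
  simp only [mul_one] at hpow
  have hstep : ∀ n : ℕ, (g (n + 1 : ℕ)).1 v₀ = step (decide (Even (n + 1)))
      (decide (Odd ⌊β + t * ((n + 1 : ℕ) : ℝ)⌋)) ((g n).1 v₀) := by
    intro n
    have e1 : L ((n + 1 : ℕ) : ℤ) = genBounded (decide (Even (n + 1))) := by
      rw [hL, letter]
      norm_cast
      by_cases h : Even (n + 1) <;> simp [h]
    have e2 := sinProfile_pos_iff (hq := hq) (h := hβ) ((n + 1 : ℕ) : ℤ)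
    rw [← hy] at e2
    rw [hg ((n + 1 : ℕ) : ℤ), e1]
    rw [show ((n + 1 : ℕ) : ℤ) - 1 = n by push_cast; ring]
    by_cases h : Even ⌊β + t * (((n + 1 : ℕ) : ℤ) : ℝ)⌋
    · rw [if_pos (e2.mpr h)]
      rw [Int.cast_natCast] at h
      simp only [Int.not_odd_iff_even.mpr h, decide_false]
      rfl
    · rw [if_neg (fun h2 => h (e2.mp h2))]
      rw [Int.cast_natCast, Int.not_even_iff_odd] at h
      simp only [h, decide_true]
      rfl
  obtain ⟨C, D, n₀, hCD⟩ := exists_forall_length_turns_eq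
    (c := fun n => decide (Even n)) (e := fun n => decide (Odd ⌊β + t * (n : ℝ)⌋))
    (v := fun n => (g n).1 v₀) (m := fun n => ⌊β + t * (n : ℝ)⌋)
    (fun n => by by_cases h : Even n <;> simp [Nat.even_add_one, h]) hstep
    (fun n => by
      have h0' : (0 : ℝ) ≤ t := by exact_mod_cast h0
      have h1' : (t : ℝ) ≤ 1 := by exact_mod_cast h1
      have a1 : ⌊β + t * (n : ℝ)⌋ ≤ ⌊β + t * ((n + 1 : ℕ) : ℝ)⌋ :=
        Int.floor_le_floor (by push_cast; linarith)
      have a2 : ⌊β + t * ((n + 1 : ℕ) : ℝ)⌋ ≤ ⌊β + t * (n : ℝ) + 1⌋ :=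
        Int.floor_le_floor (by push_cast; linarith)
      rw [Int.floor_add_one] at a2
      omega)
    (fun n => by simp)
  -- For `q = 0` the transport is trivial; otherwise the powers sample the sequence along `2qk`.
  rcases Nat.eq_zero_or_pos q with rfl | hqpos
  · have hp0 : p = 0 := by
      have : (p : ℚ) = 0 := by rw [← hp]; simp
      exact_mod_cast this
    refine ⟨|State.length v₀| + |State.turns v₀|, 0, fun k _ => ?_⟩
    rw [hpow k, hp0]
    simp [hg0]
  · refine ⟨|C| + |⌊β⌋ + D|, n₀, fun k hk => ?_⟩
    have hk' : n₀ ≤ 2 * q * k := by nlinarith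
    obtain ⟨b1, b2⟩ := hCD (2 * q * k) hk'
    have hfl : ⌊β + t * ((2 * q * k : ℕ) : ℝ)⌋ = ⌊β⌋ + 2 * p * k := by
      have hp' : (q : ℝ) * (t : ℝ) = p := by exact_mod_cast hp
      have : β + t * ((2 * q * k : ℕ) : ℝ) = β + ((2 * p * k : ℤ) : ℝ) := by
        push_cast; rw [← hp']; ring
      rw [this, Int.floor_add_intCast]
    rw [hfl] at b2
    rw [hpow k]
    push_cast at b1 b2
    rw [b1, b2]
    constructor
    · rw [show (2 * q * k + C - 2 * q * k : ℤ) = C by ring]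
      linarith [abs_nonneg (⌊β⌋ + D)]
    · rw [show (⌊β⌋ + 2 * p * k + D - 2 * p * k : ℤ) = ⌊β⌋ + D by ring]
      linarith [abs_nonneg C]

/-! ### Recovering the slope -/

lemma exists_unit_slope (s : ℚ) :
    ∃ (t : ℚ) (k : ℤ), 0 ≤ t ∧ t ≤ 1 ∧ (t = s + 2 * k ∨ t = -s + 2 * k) := by
  have h1 := Int.floor_le (s / 2)
  have h2 := Int.lt_floor_add_one (s / 2)
  by_cases h : s - 2 * ⌊s / 2⌋ ≤ 1
  · exact ⟨s - 2 * ⌊s / 2⌋, -⌊s / 2⌋, by linarith, h, Or.inl (by push_cast; ring)⟩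
  · exact ⟨-s + 2 * (⌊s / 2⌋ + 1), ⌊s / 2⌋ + 1, by linarith, by linarith,
      Or.inr (by push_cast; ring)⟩

/-- A curve of slope `s`, with either orientation, is a sine curve whose slope is the
representative in `[0, 1]` of `s` up to sign and even integers. -/
lemma exists_sinProfile_unit_slope {s : ℚ} {x : Regular} {α : Path x x} {a b : ℝ}
    {h : MissesLattice s a b}
    (hα : UnorientedHomotopic α ((lineLoop s a b h).map continuous_inclusion)) :
    ∃ (t : ℚ) (k : ℤ), 0 ≤ t ∧ t ≤ 1 ∧ (t = s + 2 * k ∨ t = -s + 2 * k) ∧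
      ∃ β hq hβ, FreelyHomotopic α (graphLoop (sinProfile s.den t β hq hβ) (1 / 2)) := by
  obtain ⟨t, k, h0, h1, ht⟩ := exists_unit_slope s
  refine ⟨t, k, h0, h1, ht, ?_⟩
  obtain ⟨β, hq, hβ, h2⟩ := exists_sinProfile_of_lineLoop_coe s a b h
  have h3 : ∃ β' hq' hβ', FreelyHomotopic ((lineLoop s a b h).map continuous_inclusion)
      (graphLoop (sinProfile s.den t β' hq' hβ') (1 / 2)) := by
    rcases ht with ht | ht
    · obtain ⟨hq', hβ', h3⟩ := exists_sinProfile_add_even (hq := hq) (h := hβ)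
        (ρ' := (t : ℝ)) (k := k) (by rw [ht]; push_cast; rfl) a
      exact ⟨β, hq', hβ', (h2.trans h3).trans (freelyHomotopic_graphLoop_base _ _ _)⟩
    · obtain ⟨hq', hβ', h3⟩ := exists_sinProfile_neg (hq := hq) (h := hβ) (ρ' := -(s : ℝ)) rfl a
      obtain ⟨hq'', hβ'', h4⟩ := exists_sinProfile_add_even (hq := hq') (h := hβ')
        (ρ' := (t : ℝ)) (k := k) (by rw [ht]; push_cast; rfl) a
      exact ⟨1 - β, hq'', hβ'',
        ((h2.trans h3).trans h4).trans (freelyHomotopic_graphLoop_base _ _ _)⟩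
  obtain ⟨β', hq', hβ', h3⟩ := h3
  rcases hα with hα | hα
  · exact ⟨β', hq', hβ', hα.trans h3⟩
  · obtain ⟨hβ'', h4⟩ := exists_sinProfile_reverse (hq := hq') (h := hβ') (1 / 2) (1 / 2)
    exact ⟨-β', hq', hβ'', (hα.trans h3.reverse).trans h4⟩

/-- Transport around a curve of a given slope determines the slope up to sign and even integers. -/
lemma exists_rates {r : OnePoint ℚ} {x : Regular} {α : Path x x} {a b : ℝ}
    {h : MissesLattice r a b}
    (hα : UnorientedHomotopic α ((lineLoop r a b h).map continuous_inclusion)) :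
    ∃ (q : ℕ) (p : ℤ), (∃ T, IsConj (transport (State.genBounded true) (State.genBounded false)
        (.mk α)) T ∧ HasRates T (2 * q) (2 * p)) ∧
      (q = 0 ∧ r = ∞ ∨ 0 < q ∧ ∃ (s : ℚ) (k : ℤ), r = s ∧
        ((p : ℚ) / q = s + 2 * k ∨ (p : ℚ) / q = -s + 2 * k)) := by
  induction r using OnePoint.rec with
  | infty =>
    obtain ⟨hq, hβ, h1⟩ := lineLoop_infty a b (1 / 2) h
    have hrates : ∀ (ρ β : ℝ), ρ = ((0 : ℚ) : ℝ) → ∀ hq hβ,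
        HasRates (transport (State.genBounded true) (State.genBounded false)
          (.mk (graphLoop (sinProfile 0 ρ β hq hβ) (1 / 2)))) (2 * (0 : ℕ)) (2 * 0) := by
      rintro _ β rfl hq hβ
      exact hasRates_transport le_rfl zero_le_one (by simp)
    refine ⟨0, 0, ?_, Or.inl ⟨rfl, rfl⟩⟩
    rcases hα with hα | hα
    · exact ⟨_, (hα.trans h1).isConj_transport, hrates 0 (1 / 2) (by simp) hq hβ⟩
    · obtain ⟨hβ', h2⟩ := exists_sinProfile_reverse (hq := hq) (h := hβ) (1 / 2) (1 / 2)
      exact ⟨_, ((hα.trans h1.reverse).trans h2).isConj_transport,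
        hrates 0 (-(1 / 2)) (by simp) hq hβ'⟩
  | coe s =>
    obtain ⟨t, k, h0, h1, ht, β, hq, hβ, h2⟩ := exists_sinProfile_unit_slope hα
    have hden : (s.den : ℚ) ≠ 0 := by exact_mod_cast s.den_ne_zero
    obtain ⟨p, hp⟩ := hq
    have hp' : (s.den : ℚ) * t = p := by exact_mod_cast hp
    refine ⟨s.den, p, ⟨_, h2.isConj_transport, hasRates_transport h0 h1 hp'⟩,
      Or.inr ⟨s.den_pos, s, k, rfl, ?_⟩⟩
    rw [← hp', mul_div_cancel_left₀ _ hden]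
    exact ht

lemma slope_of_orbifoldHomotopic {r r' : OnePoint ℚ} {x y : Regular} {α : Path x x} {β : Path y y}
    {a b a' b' : ℝ} {h : MissesLattice r a b} {h' : MissesLattice r' a' b'}
    (hα : UnorientedHomotopic α ((lineLoop r a b h).map continuous_inclusion))
    (hβ : UnorientedHomotopic β ((lineLoop r' a' b' h').map continuous_inclusion))
    (hαβ : OrbifoldHomotopic α β) :
    ∃ k : ℤ, r' = OnePoint.map (fun s : ℚ => s + 2 * k) r ∨
        r' = OnePoint.map (fun s : ℚ => -s + 2 * k) r := by
  obtain ⟨q, p, ⟨T, hT, hr⟩, hq⟩ := exists_rates hα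
  obtain ⟨q', p', ⟨T', hT', hr'⟩, hq'⟩ := exists_rates hβ
  have hconj := hαβ.isConj_transport (State.genBounded_pow_three true)
    (State.genBounded_pow_three false)
  obtain ⟨e1, e2⟩ := hr.eq_of_isConj hr' ((hT.symm.trans hconj).trans hT')
  obtain rfl : q = q' := by omega
  obtain rfl : p = p' := by omega
  rcases hq with ⟨hq0, rfl⟩ | ⟨hq0, s, k, rfl, hs⟩ <;>
    rcases hq' with ⟨hq0', rfl⟩ | ⟨hq0', s', k', rfl, hs'⟩
  · exact ⟨0, Or.inl (by simp)⟩
  · omega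
  · omega
  · rcases hs with hs | hs <;> rcases hs' with hs' | hs'
    · exact ⟨k - k', Or.inl (by simp only [OnePoint.map_some]; congr 1; push_cast; linarith)⟩
    · exact ⟨k' - k, Or.inr (by simp only [OnePoint.map_some]; congr 1; push_cast; linarith)⟩
    · exact ⟨k - k', Or.inr (by simp only [OnePoint.map_some]; congr 1; push_cast; linarith)⟩
    · exact ⟨k' - k, Or.inl (by simp only [OnePoint.map_some]; congr 1; push_cast; linarith)⟩

end ConedBall

end

/-- For slopes `r = p/q` and `r' = p'/q'` in `ℚ ∪ {∞}`, the unoriented curves `γ_r` and `γ_r'` on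
`∂S` are homotopic in `S` if and only if `r' = ± r + 2k` for some integer `k`
(where `± ∞ + 2k = ∞`). -/
theorem mainTheorem5 (r r' : OnePoint ℚ) {x y : ConedBall.PuncturedBoundary}
    (γ : Path x x) (γ' : Path y y) (hγ : ConedBall.IsGamma r γ) (hγ' : ConedBall.IsGamma r' γ') :
    ConedBall.HomotopicInS γ γ' ↔
      ∃ k : ℤ, r' = OnePoint.map (fun s : ℚ => s + 2 * k) r ∨
        r' = OnePoint.map (fun s : ℚ => -s + 2 * k) r := by
  constructor
  · obtain ⟨a, b, h, h1⟩ := hγ.exists_lineLoop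
    obtain ⟨a', b', h', h2⟩ := hγ'.exists_lineLoop
    rintro (h3 | h3)
    · exact ConedBall.slope_of_orbifoldHomotopic h1 h2 h3
    · refine ConedBall.slope_of_orbifoldHomotopic h1 ?_ h3 (h' := h')
      rcases h2 with h2 | h2
      · exact Or.inr (by rw [← Path.map_symm]; exact h2.reverse)
      · exact Or.inl (by have := h2.reverse; rwa [Path.symm_symm, Path.map_symm] at this)
  · rintro ⟨k, hk⟩
    exact ConedBall.homotopicInS_of_slope hγ hγ' hk
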